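/- Let $\mathfrak A^{CAR}$ be the CAR algebra over $\mathbb Z$, i.e. the unital $C^*$-algebra generated by $c_j$ ($j\in\mathbb Z$) with $\{c_j,c_k\}=0$ and $\{c_j,c_k^*\}=\delta_{jk}1$. Let $\Theta$ be its parity automorphism, $\Theta(c_j)=-c_j$ for all $j$, let $\Theta_-$ be the automorphism with $\Theta_-(c_j)=-c_j$ for $j\le 0$ and $\Theta_-(c_j)=c_j$ for $j>0$, and let $\tau_j$ be the translation, $\tau_j(c_k)=c_{k+j}$. Let $\tilde{\mathfrak A}$ be the crossed product of $\mathfrak A^{CAR}$ by the $\mathbb Z_2$-action $\Theta_-$, i.e. the $C^*$-algebra generated by $\mathfrak A^{CAR}$ and a unitary $T=T^*$, $T^2=1$, $TQT=\Theta_-(Q)$, and extend $\Theta$ to it by $\Theta(T)=T$. Let $\mathfrak A\subset\tilde{\mathfrak A}$ be the algebra of the spin-$\tfrac12$ chain, that is, the $C^*$-subalgebra generated by $$\sigma_z^{(j)}=2c_j^*c_j-1,\qquad \sigma_x^{(j)}=TS_j(c_j+c_j^*),\qquad \sigma_y^{(j)}=iTS_j(c_j-c_j^*)\qquad(j\in\mathbb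 Z),$$ where $S_n=\sigma_z^{(1)}\cdots\sigma_z^{(n-1)}$ for $n>1$, $S_1=1$, and $S_n=\sigma_z^{(0)}\sigma_z^{(-1)}\cdots\sigma_z^{(n)}$ for $n<1$. The translation $\tau_j$ of $\mathfrak A$ is the automorphism with $\tau_j(\sigma_a^{(k)})=\sigma_a^{(k+j)}$ for $a=x,y,z$. For $\Lambda\subset\mathbb Z$ let $\mathfrak A_\Lambda$ be the $C^*$-subalgebra of $\mathfrak A$ generated by the $\sigma_a^{(j)}$ with $j\in\Lambda$, and put $\mathfrak A_L=\mathfrak A_{(-\infty,0]}$ and $\mathfrak A_R=\mathfrak A_{[1,\infty)}$. A subscript $+$ on an algebra denotes its $\Theta$-fixed part; one has $(\mathfrak A)_+=(\mathfrak A^{CAR})_+$. For a state $\varphi$ let $(\pi_\varphi,\Omega_\varphi,\mathfrak H_\varphi)$ be its GNS triple. States are called unitarily equivalent if their GNS representations are; a double prime denotes the bicommutant; a state is translationally invariant if it is invariant under all $\tau_j$. Let $\psi$ be a $\Theta$-invariant pure state of $\mathfrak A^{CAR}$ and let $\psi_+$ be its restriction to $(\mathfrak A^{CAR})_+$. (i)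 Suppose that $\psi$ and $\psi\circ\Theta_-$ are not unitarily equivalent. Then $\psi_+$ has a unique extension to a $\Theta$-invariant state $\varphi$ of $\mathfrak A$, and $\varphi$ is pure. If $\psi$ is translationally invariant, so is $\varphi$. (ii) Suppose that $\psi$ and $\psi\circ\Theta_-$ are unitarily equivalent and that $\psi_+$ and $\psi_+\circ\Theta_-$ are unitarily equivalent as states of $(\mathfrak A^{CAR})_+$. Then $\psi_+$ has a unique extension to a $\Theta$-invariant state $\varphi$ of $\mathfrak A$, and $\varphi$ is pure. If $\psi$ is translationally invariant, so is $\varphi$. (iii) Suppose that $\psi$ and $\psi\circ\Theta_-$ are unitarily equivalent and that $\psi_+$ and $\psi_+\circ\Theta_-$ are not unitarily equivalent as states of $(\mathfrak A^{CAR})_+$. Then there is a pure state $\varphi$ of $\mathfrak A$ that extends $\psi_+$, is not $\Theta$-invariant, and has the following properties. There is a unitary $U:\mathfrak H_{\psi_+}\to\mathfrak H_\varphi$ with $U\Omega_{\psi_+}=\Omega_\varphi$ and $U\pi_{\psi_+}(Q)=\pi_\varphi(Q)U$ for all $Q\in(\mathfrak A^{CAR})_+$, and $$\pi_\varphi(\mathfrak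 A)''=\pi_\varphi((\mathfrak A)_+)''.$$ If $\psi$ is translationally invariant, then moreover $\varphi\circ\tau_2=\varphi$ and $$\pi_\varphi(\mathfrak A_L)''=\pi_\varphi((\mathfrak A_L)_+)'',\qquad \pi_\varphi(\mathfrak A_R)''=\pi_\varphi((\mathfrak A_R)_+)''.$$ -/

import Mathlib

open scoped ComplexOrder InnerProductSpace lp
noncomputable section

instance closedStarSubalgebra_starOrderedRing {A : Type*} [CStarAlgebra A] [PartialOrder A]
    [StarOrderedRing A] (S : StarSubalgebra ℂ A) [IsClosed (S : Set A)] : StarOrderedRing S := by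
  refine StarOrderedRing.of_nonneg_iff' (fun {x y} h z => ?_) (fun x => ⟨fun hx => ?_, ?_⟩)
  · have h' : (x : A) ≤ y := h
    exact add_le_add_right h' (z : A)
  · have hx' : (0 : A) ≤ (x : A) := hx
    have hsa : IsSelfAdjoint x := Subtype.ext (IsSelfAdjoint.of_nonneg hx')
    have hsp : QuasispectrumRestricts x ContinuousMap.realToNNReal := by
      rw [quasispectrumRestricts_iff_spectrumRestricts, SpectrumRestricts.nnreal_iff]
      intro r hr
      have h1 : (algebraMap ℝ ℂ r) ∈ spectrum ℂ x := (spectrum.algebraMap_mem_iff ℂ).2 hr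
      rw [StarSubalgebra.spectrum_eq] at h1
      exact spectrum_nonneg_of_nonneg hx' ((spectrum.algebraMap_mem_iff ℂ).1 h1)
    obtain ⟨s, hs₁, _, hs₂⟩ :=
      CFC.exists_sqrt_of_isSelfAdjoint_of_quasispectrumRestricts hsa hsp
    exact ⟨s, by rw [hs₁.star_eq, hs₂]⟩
  · rintro ⟨s, rfl⟩
    exact star_mul_self_nonneg (s : A)

theorem weighted_summable {ι : Type*} (f : ι ≃ ι) (v : ℓ²(ι, ℂ)) :
    Summable fun i => ‖v (f i)‖ ^ (2 : ENNReal).toReal :=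
  (f.summable_iff (f := fun i => ‖v i‖ ^ (2 : ENNReal).toReal)).2
    ((memℓp_gen_iff (by simp)).1 (lp.memℓp v))

theorem weighted_le {ι : Type*} (f : ι ≃ ι) (w : ι → ℂ) (hw : ∀ i, ‖w i‖ ≤ 1) (v : ℓ²(ι, ℂ))
    (i : ι) : ‖w i * v (f i)‖ ^ (2 : ENNReal).toReal ≤ ‖v (f i)‖ ^ (2 : ENNReal).toReal := by
  rw [norm_mul]
  exact Real.rpow_le_rpow (by positivity)
    (mul_le_of_le_one_left (norm_nonneg _) (hw i)) (by simp)

theorem weighted_mem {ι : Type*} (f : ι ≃ ι) (w : ι → ℂ) (hw : ∀ i, ‖w i‖ ≤ 1) (v : ℓ²(ι, ℂ)) :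
    Memℓp (E := fun _ : ι => ℂ) (fun i => w i * v (f i)) 2 :=
  (memℓp_gen_iff (by simp)).2
    ((weighted_summable f v).of_nonneg_of_le (fun i => by positivity) (weighted_le f w hw v))

theorem weighted_norm_le {ι : Type*} (f : ι ≃ ι) (w : ι → ℂ) (hw : ∀ i, ‖w i‖ ≤ 1)
    (v : ℓ²(ι, ℂ)) : ‖(⟨_, weighted_mem f w hw v⟩ : ℓ²(ι, ℂ))‖ ≤ 1 * ‖v‖ := by
  rw [one_mul]
  have h := lp.norm_rpow_eq_tsum (p := 2) (by simp) (⟨_, weighted_mem f w hw v⟩ : ℓ²(ι, ℂ))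
  have h' := lp.norm_rpow_eq_tsum (p := 2) (by simp) v
  refine (Real.rpow_le_rpow_iff (z := (2 : ENNReal).toReal)
    (norm_nonneg _) (norm_nonneg _) (by simp)).1 ?_
  refine h.trans_le (le_trans ?_ h'.ge)
  rw [← f.tsum_eq (fun i => ‖v i‖ ^ (2 : ENNReal).toReal)]
  exact ((weighted_summable f v).of_nonneg_of_le (fun i => by positivity)
    (weighted_le f w hw v)).tsum_le_tsum (weighted_le f w hw v) (weighted_summable f v)

/-- The weighted permutation operator on `ℓ²(ι)`: `(weightedPerm f w v) i = w i * v (f i)`. -/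
def weightedPerm {ι : Type*} (f : ι ≃ ι) (w : ι → ℂ) (hw : ∀ i, ‖w i‖ ≤ 1) :
    ℓ²(ι, ℂ) →L[ℂ] ℓ²(ι, ℂ) :=
  LinearMap.mkContinuous
    { toFun := fun v => ⟨fun i => w i * v (f i), weighted_mem f w hw v⟩
      map_add' := fun u v => lp.ext (funext fun i => mul_add (w i) (u (f i)) (v (f i)))
      map_smul' := fun a v => lp.ext (funext fun i => mul_left_comm (w i) a (v (f i))) } 1
    (weighted_norm_le f w hw)

section

variable {ι : Type*} (f : ι ≃ ι) (w : ι → ℂ) (hw : ∀ i, ‖w i‖ ≤ 1)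

theorem weightedPerm_apply (v : ℓ²(ι, ℂ)) (i : ι) :
    weightedPerm f w hw v i = w i * v (f i) := rfl

theorem star_weightedPerm_apply (v : ℓ²(ι, ℂ)) (i : ι) :
    star (weightedPerm f w hw) v i = star (w (f.symm i)) * v (f.symm i) := by
  have hw' : ∀ i, ‖star (w (f.symm i))‖ ≤ 1 := fun i => by rw [norm_star]; exact hw _
  have h : weightedPerm f.symm (fun i => star (w (f.symm i))) hw' = star (weightedPerm f w hw) := by
    rw [ContinuousLinearMap.star_eq_adjoint, ContinuousLinearMap.eq_adjoint_iff]
    intro x y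
    refine (lp.hasSum_inner _ _).unique ?_
    have := (f.symm.hasSum_iff (f := fun i => ⟪x i, weightedPerm f w hw y i⟫_ℂ)).2
      (lp.hasSum_inner x (weightedPerm f w hw y))
    refine (congrArg (fun F => HasSum F _) (funext fun i => ?_)).mp this
    simp [weightedPerm_apply, RCLike.inner_apply]
    ring
  rw [← h, weightedPerm_apply]
end

/-! States, purity, GNS representations -/

section States

variable {A : Type*} [CStarAlgebra A] [PartialOrder A] [StarOrderedRing A]
variable {B : Type*} [CStarAlgebra B] [PartialOrder B] [StarOrderedRing B]

/-- A state is a normalized positive linear functional. -/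
def IsState (φ : A →ₚ[ℂ] ℂ) : Prop := φ 1 = 1

/-- A pure state is an extreme point of the convex set of all states. -/
def IsPureState (φ : A →ₚ[ℂ] ℂ) : Prop :=
  φ.toLinearMap ∈
    Set.extremePoints ℝ {f : A →ₗ[ℂ] ℂ | ∃ ω : A →ₚ[ℂ] ℂ, IsState ω ∧ ω.toLinearMap = f}

/-- The functional `φ ∘ α` for a unital `*`-homomorphism `α`. -/
def pullback (φ : B →ₚ[ℂ] ℂ) (α : A →⋆ₐ[ℂ] B) : A →ₚ[ℂ] ℂ := φ.comp (.ofClass α)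

/-- The canonical cyclic vector of the GNS representation of `φ`. -/
def gnsVector (φ : A →ₚ[ℂ] ℂ) : φ.GNS := ((φ.toPreGNS 1 : φ.PreGNS) : φ.GNS)

/-- Two states are unitarily equivalent if their GNS representations are. -/
def UnitarilyEquivalent (φ ω : A →ₚ[ℂ] ℂ) : Prop :=
  ∃ U : φ.GNS ≃ₗᵢ[ℂ] ω.GNS, ∀ (a : A) (ξ : φ.GNS),
    U (φ.gnsStarAlgHom a ξ) = ω.gnsStarAlgHom a (U ξ)

/-- The von Neumann algebra `π_φ(M)''` on the GNS space of `φ` (as a set of operators). -/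
def gnsBicommutant (φ : A →ₚ[ℂ] ℂ) (M : Set A) : Set (φ.GNS →L[ℂ] φ.GNS) :=
  (φ.gnsStarAlgHom '' M).centralizer.centralizer

end States

/-- A weighted permutation operator with weights of modulus one is unitary. -/
def weightedUnitary {ι : Type*} (f : ι ≃ ι) (w : ι → ℂ) (hw : ∀ i, ‖w i‖ = 1) :
    unitary (ℓ²(ι, ℂ) →L[ℂ] ℓ²(ι, ℂ)) :=
  ⟨weightedPerm f w (fun i => (hw i).le), by
    have hc : ∀ i, (starRingEnd ℂ) (w i) * w i = 1 := fun i => by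
      rw [mul_comm, Complex.mul_conj, Complex.normSq_eq_norm_sq, hw]; simp
    rw [Unitary.mem_iff]
    constructor
    · ext v i
      rw [mul_apply_eq_comp, star_weightedPerm_apply, weightedPerm_apply, ← mul_assoc]
      simp [hc]
    · ext v i
      rw [mul_apply_eq_comp, weightedPerm_apply, star_weightedPerm_apply, ← mul_assoc,
        mul_comm (w i)]
      simp [hc]⟩

namespace JordanWigner

/-- A basis configuration: a finite set of occupied sites, and one of two copies of Fock space. -/
abbrev Config : Type := Finset ℤ × Bool
/-- Two copies of the fermionic Fock space over `ℤ`, `ℓ²(finite subsets of ℤ) ⊗ ℂ²`. -/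
abbrev Space : Type := ℓ²(Config, ℂ)
/-- The algebra of bounded operators on `Space`. -/
def Op : Type := Space →L[ℂ] Space

instance : CStarAlgebra Op := inferInstanceAs (CStarAlgebra (Space →L[ℂ] Space))
instance : PartialOrder Op := inferInstanceAs (PartialOrder (Space →L[ℂ] Space))
instance : StarOrderedRing Op := inferInstanceAs (StarOrderedRing (Space →L[ℂ] Space))
instance : FunLike Op Space Space := inferInstanceAs (FunLike (Space →L[ℂ] Space) Space Space)

namespace Op
theorem ext {a b : Op} (h : ∀ (v : Space) (p : Config), a v p = b v p) : a = b :=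
  ContinuousLinearMap.ext (M₁ := Space) (M₂ := Space) (σ₁₂ := RingHom.id ℂ)
    fun v => lp.ext (funext (h v))
theorem mul_apply (a b : Op) (v : Space) : (a * b) v = a (b v) := rfl
@[simp]
theorem one_apply (v : Space) : (1 : Op) v = v := rfl
@[simp]
theorem zero_apply (v : Space) (p : Config) : (0 : Op) v p = 0 := rfl
theorem add_apply (a b : Op) (v : Space) (p : Config) : (a + b) v p = a v p + b v p := rfl
theorem sub_apply (a b : Op) (v : Space) (p : Config) : (a - b) v p = a v p - b v p := rfl
theorem neg_apply (a : Op) (v : Space) (p : Config) : (-a) v p = -(a v p) := rfl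
theorem smul_apply (r : ℂ) (a : Op) (v : Space) (p : Config) : (r • a) v p = r * a v p := rfl
end Op

/-- Change the occupation of the site `j`. -/
def toggle (j : ℤ) : Config ≃ Config where
  toFun p := (symmDiff p.1 {j}, p.2)
  invFun p := (symmDiff p.1 {j}, p.2)
  left_inv p := by simp
  right_inv p := by simp

/-- Move all occupied sites by `-1`. -/
def shift : Config ≃ Config :=
  (Equiv.finsetCongr (Equiv.subRight (1 : ℤ))).prodCongr (Equiv.refl Bool)

/-- Exchange the two copies of Fock space. -/
def boolFlip : Config ≃ Config := (Equiv.refl _).prodCongr Equiv.boolNot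

/-- The annihilation operator `c_j` of the Fock representation, acting identically on both copies:
`(c_j v)(F) = (-1)^#{i ∈ F, i < j} v(F ∪ {j})` if `j ∉ F`, and `0` otherwise. -/
def c (j : ℤ) : Op :=
  weightedPerm (toggle j)
    (fun p => if j ∈ p.1 then 0 else (-1) ^ (p.1.filter (· < j)).card)
    (fun p => by split_ifs <;> simp)

/-- The unitary `(-1)^N` on both copies; it implements the parity `Θ`. -/
def parityOp : unitary Op :=
  weightedUnitary (Equiv.refl _) (fun p => (-1) ^ p.1.card) (fun p => by simp)

/-- The selfadjoint unitary `T = (-1)^{N_{(-∞,0]}} ⊗ (exchange of the copies)`. Its conjugation action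
on the CAR algebra is `Θ_-`. As `a + b T = 0` with `a`, `b` in the CAR algebra (which acts identically
on both copies) forces `a = b = 0`, the `C*`-algebra generated by the CAR algebra and `T` is the
crossed product of the CAR algebra by the `ℤ₂`-action `Θ_-`. -/
def T : unitary Op :=
  weightedUnitary boolFlip (fun p => (-1) ^ (p.1.filter (· ≤ 0)).card) (fun p => by simp)

/-- The unitary that shifts the occupied sites by `1`, with a sign `-1` on the second copy. Its
conjugation action maps `c_j` to `c_{j+1}` and `T` to `T σ_z^{(1)}`, hence `σ_a^{(j)}` to
`σ_a^{(j+1)}` for `a = x, y, z`. -/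
def shiftOp : unitary Op :=
  weightedUnitary shift (fun p => if p.2 then -1 else 1) (fun p => by split_ifs <;> simp)

/-- `σ_z^{(j)} = 2 c_j^* c_j - 1`. -/
def σz (j : ℤ) : Op := (2 : ℂ) • (star (c j) * c j) - 1

theorem neg_one_pow_mul_self (n : ℕ) : ((-1 : ℂ) ^ n) * (-1) ^ n = 1 := by
  rw [← pow_add, Even.neg_one_pow (by simp)]

theorem c_apply (j : ℤ) (v : Space) (p : Config) : c j v p =
    (if j ∈ p.1 then 0 else (-1) ^ (p.1.filter (· < j)).card) * v (symmDiff p.1 {j}, p.2) := rfl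

theorem star_c_apply (j : ℤ) (v : Space) (p : Config) : star (c j) v p =
    (if j ∈ p.1 then (-1) ^ (p.1.filter (· < j)).card else 0) * v (symmDiff p.1 {j}, p.2) := by
  refine (star_weightedPerm_apply _ _ _ v p).trans ?_
  simp only [toggle, Equiv.coe_fn_symm_mk, Finset.mem_symmDiff, Finset.mem_singleton]
  by_cases h : j ∈ p.1
  · have : (symmDiff p.1 {j}).filter (· < j) = p.1.filter (· < j) := by
      ext k; simp [Finset.mem_symmDiff]; grind
    simp [h, this]
  · simp [h]

theorem σz_apply (j : ℤ) (v : Space) (p : Config) :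
    σz j v p = (if j ∈ p.1 then 1 else -1) * v p := by
  have : σz j v p = 2 * (star (c j) (c j v)) p - v p := rfl
  rw [this, star_c_apply, c_apply]
  have h2 : (symmDiff p.1 {j}).filter (· < j) = p.1.filter (· < j) := by
    ext k; simp [Finset.mem_symmDiff]; grind
  by_cases h : j ∈ p.1
  · simp [h, h2, Finset.mem_symmDiff]
    have := neg_one_pow_mul_self (p.1.filter (· < j)).card
    linear_combination (2 * v p) * this
  · simp [h]

theorem symm_card (p : Finset ℤ) (j : ℤ) (h : j ∉ p) : (symmDiff p {j}) = insert j p := by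
  ext k; simp [Finset.mem_symmDiff]; grind

theorem T_apply (v : Space) (p : Config) :
    (T : Op) v p = (-1) ^ (p.1.filter (· ≤ 0)).card * v (p.1, !p.2) := rfl

theorem star_T : star (T : Op) = T := by
  refine Op.ext fun v p => ?_
  refine (star_weightedPerm_apply _ _ (fun p => by simp) v p).trans ?_
  rw [T_apply]
  cases hp : p.2 <;> simp [boolFlip, Prod.map, hp]

theorem T_mul_T : (T : Op) * T = 1 := by
  nth_rw 1 [← star_T]
  exact Unitary.star_mul_self_of_mem T.2

theorem parity_apply (v : Space) (p : Config) :
    (parityOp : Op) v p = (-1) ^ p.1.card * v p := rfl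

theorem star_parity : star (parityOp : Op) = parityOp := by
  refine Op.ext fun v p => ?_
  refine (star_weightedPerm_apply _ _ (fun p => by simp) v p).trans ?_
  rw [parity_apply]
  simp

theorem shift_apply (v : Space) (p : Config) :
    (shiftOp : Op) v p = (if p.2 then -1 else 1) * v (shift p) := rfl

theorem parity_mul_c (j : ℤ) : (parityOp : Op) * c j = -(c j * parityOp) := by
  refine Op.ext fun v p => ?_
  simp only [Op.mul_apply, parity_apply, c_apply, Op.neg_apply]
  by_cases h : j ∈ p.1
  · simp [h]
  · simp [h, symm_card, pow_succ]; ring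

theorem T_mul_c (j : ℤ) : (T : Op) * c j = (if j ≤ 0 then -1 else 1 : ℂ) • (c j * T) := by
  refine Op.ext fun v p => ?_
  simp only [Op.mul_apply, T_apply, c_apply, Op.smul_apply]
  by_cases h : j ∈ p.1
  · simp [h]
  · by_cases hj : j ≤ 0
    · simp [h, symm_card, hj, Finset.filter_insert, pow_succ]; ring
    · simp [h, symm_card, hj, Finset.filter_insert]; ring

theorem parity_mul_T : (parityOp : Op) * T = T * parityOp := by
  refine Op.ext fun v p => ?_
  simp only [Op.mul_apply, T_apply, parity_apply]
  ring

theorem shift_mul_c (j : ℤ) : (shiftOp : Op) * c j = c (j + 1) * shiftOp := by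
  refine Op.ext fun v p => ?_
  simp only [Op.mul_apply, shift_apply, c_apply]
  have h1 : j ∈ (shift p).1 ↔ j + 1 ∈ p.1 := by simp [shift]
  have h2 : ((shift p).1.filter (· < j)).card = (p.1.filter (· < j + 1)).card := by
    rw [← Finset.card_map (f := (Equiv.subRight (1 : ℤ)).toEmbedding)
      (s := p.1.filter (· < j + 1))]
    congr 1; ext k; simp [shift]
  have h3 : shift (symmDiff p.1 {j + 1}, p.2) = (symmDiff (shift p).1 {j}, (shift p).2) := by
    ext k
    · simp [shift, Finset.mem_symmDiff]
    · simp [shift]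
  rw [h2, h3]; simp only [h1]; ring

theorem shift_mul_T : (shiftOp : Op) * T = T * σz 1 * shiftOp := by
  refine Op.ext fun v p => ?_
  simp only [Op.mul_apply, shift_apply, T_apply, σz_apply]
  have h2 : ((shift p).1.filter (· ≤ 0)).card = (p.1.filter (· ≤ 1)).card := by
    rw [← Finset.card_map (f := (Equiv.subRight (1 : ℤ)).toEmbedding) (s := p.1.filter (· ≤ 1))]
    congr 1; ext k; simp [shift]
  have h3 : shift (p.1, !p.2) = ((shift p).1, !(shift p).2) := rfl
  rw [h2, h3]
  by_cases h : (1 : ℤ) ∈ p.1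
  · have : p.1.filter (· ≤ 1) = insert 1 (p.1.filter (· ≤ 0)) := by ext k; simp; grind
    rw [this, Finset.card_insert_of_notMem (by simp)]
    cases hp : p.2 <;> simp [h, pow_succ]
  · have : p.1.filter (· ≤ 1) = (p.1.filter (· ≤ 0)) := by ext k; simp; grind
    rw [this]
    cases hp : p.2 <;> simp [h]

/-- The canonical anticommutation relations. -/
theorem car_rel (j k : ℤ) :
    c j * star (c k) + star (c k) * c j = if j = k then 1 else 0 := by
  refine Op.ext fun v p => ?_
  by_cases hjk : j = k
  · subst hjk
    have h2 : (symmDiff p.1 {j}).filter (· < j) = p.1.filter (· < j) := by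
      ext k; simp [Finset.mem_symmDiff]; grind
    simp only [Op.add_apply, Op.mul_apply, c_apply, star_c_apply]
    by_cases h : j ∈ p.1 <;> simp [h, h2, Finset.mem_symmDiff] <;>
      rw [← mul_assoc, ← pow_add, Even.neg_one_pow (by simp), one_mul]
  · simp only [Op.add_apply, Op.mul_apply, c_apply, star_c_apply]
    have e : symmDiff (symmDiff p.1 {j}) {k} = symmDiff (symmDiff p.1 {k}) {j} := by
      rw [symmDiff_assoc, symmDiff_comm ({j} : Finset ℤ) {k}, ← symmDiff_assoc]
    rw [e]
    by_cases h : j ∈ p.1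
    · simp [h, hjk, Finset.mem_symmDiff]
    · by_cases h' : k ∈ p.1
      · have h1 : symmDiff p.1 {k} = p.1.erase k := by ext; simp [Finset.mem_symmDiff]; grind
        have h2 : symmDiff p.1 {j} = insert j p.1 := symm_card _ _ h
        simp only [h, h', hjk, h1, h2, Finset.filter_insert, Finset.filter_erase]
        rcases lt_or_gt_of_ne hjk with hl | hl
        · simp [h, h', hjk, hl, hl.not_gt, pow_succ, Ne.symm hjk]; ring
        · have h3 : k ∈ p.1.filter (· < j) := by simp [h', hl]
          have h4 := Finset.card_erase_add_one h3
          simp only [h', hl.not_gt, Finset.mem_insert, or_true, if_true, if_false,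
            Finset.mem_erase, h, and_false, ← h4, pow_succ, Op.zero_apply]
          ring
      · simp [h, h', Ne.symm hjk, hjk, Finset.mem_symmDiff]

theorem car_rel' (j k : ℤ) : c j * c k + c k * c j = 0 := by
  refine Op.ext fun v p => ?_
  simp only [Op.add_apply, Op.mul_apply, c_apply]
  have e : symmDiff (symmDiff p.1 {j}) {k} = symmDiff (symmDiff p.1 {k}) {j} := by
      rw [symmDiff_assoc, symmDiff_comm ({j} : Finset ℤ) {k}, ← symmDiff_assoc]
  rw [e]
  by_cases hjk : j = k
  · subst hjk; by_cases h : j ∈ p.1 <;> simp [h, Finset.mem_symmDiff]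
  by_cases h : j ∈ p.1
  · simp [h, hjk, Finset.mem_symmDiff]
  by_cases h' : k ∈ p.1
  · simp [h, h', Ne.symm hjk, Finset.mem_symmDiff]
  · simp only [h, h', symm_card p.1 _ h, symm_card p.1 _ h', Finset.filter_insert]
    rcases lt_or_gt_of_ne hjk with hl | hl
    · simp [h, h', hjk, hl, hl.not_gt, pow_succ, Ne.symm hjk]; ring
    · simp [h, h', hjk, hl, hl.not_gt, pow_succ, Ne.symm hjk]; ring

/-- `S_n = σ_z^{(1)} ⋯ σ_z^{(n-1)}` for `n > 1`, `S_1 = 1`, and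
`S_n = σ_z^{(0)} σ_z^{(-1)} ⋯ σ_z^{(n)}` for `n < 1`. -/
def S (n : ℤ) : Op :=
  if 1 ≤ n then ((List.range (n - 1).toNat).map fun k : ℕ => σz (k + 1)).prod
  else ((List.range (1 - n).toNat).map fun k : ℕ => σz (-k)).prod

/-- `σ_x^{(j)} = T S_j (c_j + c_j^*)`. -/
def σx (j : ℤ) : Op := T * S j * (c j + star (c j))

/-- `σ_y^{(j)} = i T S_j (c_j - c_j^*)`. -/
def σy (j : ℤ) : Op := Complex.I • (T * S j * (c j - star (c j)))

/-- The unital `C*`-algebra generated by a set of operators. -/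
def generatedBy (G : Set Op) : StarSubalgebra ℂ Op := (StarAlgebra.adjoin ℂ G).topologicalClosure

instance (G : Set Op) : IsClosed (generatedBy G : Set Op) :=
  StarSubalgebra.isClosed_topologicalClosure _

/-- The CAR algebra over `ℤ`. -/
def carAlgebra : StarSubalgebra ℂ Op := generatedBy (Set.range c)

instance : IsClosed (carAlgebra : Set Op) := inferInstanceAs (IsClosed (generatedBy _ : Set Op))

/-- The `C*`-algebra of spin observables localized in `Λ`. -/
def spinAlgebraOn (Λ : Set ℤ) : StarSubalgebra ℂ Op :=
  generatedBy (σx '' Λ ∪ σy '' Λ ∪ σz '' Λ)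

/-- The `C*`-algebra of the spin chain, as a subalgebra of the crossed product. -/
def spinAlgebra : StarSubalgebra ℂ Op := spinAlgebraOn Set.univ

instance : IsClosed (spinAlgebra : Set Op) := inferInstanceAs (IsClosed (generatedBy _ : Set Op))

/-- The parity automorphism: `c_j ↦ -c_j`, `T ↦ T`. -/
def Θ : Op ≃⋆ₐ[ℂ] Op := Unitary.conjStarAlgAut ℂ Op parityOp

/-- The automorphism `Q ↦ T Q T`: `c_j ↦ -c_j` for `j ≤ 0`, `c_j ↦ c_j` for `j > 0`. -/
def Θm : Op ≃⋆ₐ[ℂ] Op := Unitary.conjStarAlgAut ℂ Op T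

/-- The lattice translation by `j`. -/
def τ (j : ℤ) : Op ≃⋆ₐ[ℂ] Op := Unitary.conjStarAlgAut ℂ Op (shiftOp ^ j)

theorem conj_eq (u : unitary Op) {a b : Op} (h : (u : Op) * a = b * u) :
    Unitary.conjStarAlgAut ℂ Op u a = b := by
  rw [Unitary.conjStarAlgAut_apply, h, mul_assoc, Unitary.mul_star_self_of_mem u.2, mul_one]

theorem continuous_conj (u : unitary Op) : Continuous (Unitary.conjStarAlgAut ℂ Op u) := by
  have : (Unitary.conjStarAlgAut ℂ Op u : Op → Op) = fun x => u * x * star (u : Op) := rfl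
  rw [this]; fun_prop

theorem conj_mem (u : unitary Op) {G : Set Op} {A : StarSubalgebra ℂ Op}
    (hA : IsClosed (A : Set Op)) (h : ∀ g ∈ G, Unitary.conjStarAlgAut ℂ Op u g ∈ A) :
    ∀ Q ∈ generatedBy G, Unitary.conjStarAlgAut ℂ Op u Q ∈ A := by
  have : generatedBy G ≤ A.comap (Unitary.conjStarAlgAut ℂ Op u : Op →⋆ₐ[ℂ] Op) :=
    StarSubalgebra.topologicalClosure_minimal (StarAlgebra.adjoin_le h)
      (hA.preimage (continuous_conj u))
  exact fun Q hQ => this hQ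

theorem mem_generatedBy {G : Set Op} {g : Op} (hg : g ∈ G) : g ∈ generatedBy G :=
  StarSubalgebra.le_topologicalClosure _ (StarAlgebra.subset_adjoin ℂ G hg)

theorem Θ_c (j : ℤ) : Θ (c j) = -c j :=
  conj_eq _ (by rw [parity_mul_c, neg_mul])

theorem Θ_T : Θ T = T := conj_eq _ parity_mul_T

theorem Θm_c (j : ℤ) : Θm (c j) = (if j ≤ 0 then -1 else 1 : ℂ) • c j :=
  conj_eq _ (by rw [T_mul_c, smul_mul_assoc])

theorem Θm_T : Θm T = T := conj_eq _ rfl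

theorem τ_one_c (j : ℤ) : τ 1 (c j) = c (j + 1) := by
  rw [τ, zpow_one]; exact conj_eq _ (shift_mul_c j)

theorem τ_one_T : τ 1 T = T * σz 1 := by
  rw [τ, zpow_one]; exact conj_eq _ shift_mul_T

theorem Θ_σz (j : ℤ) : Θ (σz j) = σz j := by
  simp [σz, map_star, Θ_c]

theorem Θm_σz (j : ℤ) : Θm (σz j) = σz j := by
  simp only [σz, map_sub, map_smul, map_mul, map_star, Θm_c, map_one]
  split_ifs <;> simp

theorem τ_one_σz (j : ℤ) : τ 1 (σz j) = σz (j + 1) := by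
  simp [σz, map_star, τ_one_c]

theorem σz_mul_self (j : ℤ) : σz j * σz j = 1 := by
  refine Op.ext fun v p => ?_
  simp only [Op.mul_apply, σz_apply]
  split_ifs <;> simp

theorem σz_comm (j k : ℤ) : σz j * σz k = σz k * σz j := by
  refine Op.ext fun v p => ?_
  simp only [Op.mul_apply, σz_apply]
  ring

theorem fix_S (α : Op ≃⋆ₐ[ℂ] Op) (h : ∀ j, α (σz j) = σz j) (n : ℤ) : α (S n) = S n := by
  unfold S
  split_ifs <;> simp [map_list_prod, Function.comp_def, h]

theorem list_prod_mul_self (l : List ℤ) : (l.map σz).prod * (l.map σz).prod = 1 := by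
  induction l with
  | nil => simp
  | cons a l ih =>
    have hc : Commute (σz a) (l.map σz).prod :=
      Commute.list_prod_right _ _ (by
        intro x hx
        obtain ⟨b, -, rfl⟩ := List.mem_map.1 hx
        exact σz_comm a b)
    simp only [List.map_cons, List.prod_cons]
    rw [mul_assoc, ← mul_assoc _ (σz a), ← hc.eq, mul_assoc, ih, mul_one, σz_mul_self]

theorem S_mul_self (n : ℤ) : S n * S n = 1 := by
  unfold S
  split_ifs
  · simpa [Function.comp_def] using
      list_prod_mul_self ((List.range (n - 1).toNat).map fun k : ℕ => (k + 1 : ℤ))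
  · simpa [Function.comp_def] using
      list_prod_mul_self ((List.range (1 - n).toNat).map fun k : ℕ => (-k : ℤ))

theorem S_succ (n : ℤ) : σz 1 * τ 1 (S n) = S (n + 1) := by
  unfold S
  rcases lt_trichotomy n 0 with h | h | h
  · have h1 : ¬ 1 ≤ n := by omega
    have h2 : ¬ 1 ≤ n + 1 := by omega
    have h3 : (1 - n).toNat = (1 - (n + 1)).toNat + 1 := by omega
    rw [if_neg h1, if_neg h2, h3, List.range_succ_eq_map]
    simp only [List.map_cons, List.prod_cons, map_mul, map_list_prod, List.map_map, τ_one_σz,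
      Function.comp_def, ← mul_assoc]
    simp [σz_mul_self]
  · subst h; simp [τ_one_σz, σz_mul_self]
  · have h1 : 1 ≤ n := by omega
    have h2 : 1 ≤ n + 1 := by omega
    have h3 : (n + 1 - 1).toNat = (n - 1).toNat + 1 := by omega
    rw [if_pos h1, if_pos h2, h3, List.range_succ_eq_map]
    simp [map_list_prod, τ_one_σz, Function.comp_def]

theorem τ_one_σx (j : ℤ) : τ 1 (σx j) = σx (j + 1) := by
  rw [σx, map_mul, map_mul, τ_one_T, mul_assoc (T : Op), S_succ]
  simp [map_star, τ_one_c, σx]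

theorem τ_one_σy (j : ℤ) : τ 1 (σy j) = σy (j + 1) := by
  rw [σy, map_smul, map_mul, map_mul, τ_one_T, mul_assoc (T : Op), S_succ]
  simp [map_star, τ_one_c, σy]

theorem Θ_σx (j : ℤ) : Θ (σx j) = -σx j := by
  simp only [σx, map_mul, Θ_T, fix_S Θ Θ_σz, map_add, map_star, Θ_c, star_neg]
  noncomm_ring

theorem Θ_σy (j : ℤ) : Θ (σy j) = -σy j := by
  simp only [σy, map_smul, map_mul, Θ_T, fix_S Θ Θ_σz, map_sub, map_star, Θ_c, star_neg]
  rw [← smul_neg]; congr 1; noncomm_ring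

theorem Θm_σx (j : ℤ) : Θm (σx j) = (if j ≤ 0 then -1 else 1 : ℂ) • σx j := by
  simp only [σx, map_mul, Θm_T, fix_S Θm Θm_σz, map_add, map_star, Θm_c]
  split_ifs
  · simp; noncomm_ring
  · simp

theorem Θm_σy (j : ℤ) : Θm (σy j) = (if j ≤ 0 then -1 else 1 : ℂ) • σy j := by
  simp only [σy, map_smul, map_mul, Θm_T, fix_S Θm Θm_σz, map_sub, map_star, Θm_c]
  split_ifs
  · simp; rw [← smul_neg]; congr 1; noncomm_ring
  · simp

theorem τ_neg_one {a b : Op} (h : τ 1 a = b) : τ (-1) b = a := by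
  rw [← h]
  have : τ (-1) (τ 1 a) = (τ (-1) * τ 1) a := rfl
  rw [this, τ, τ, ← map_mul, ← zpow_add]; simp

theorem τ_mem {A : StarSubalgebra ℂ Op} (h1 : ∀ Q ∈ A, τ 1 Q ∈ A) (h2 : ∀ Q ∈ A, τ (-1) Q ∈ A)
    (j : ℤ) : ∀ Q ∈ A, τ j Q ∈ A := by
  have hadd : ∀ j k Q, τ (j + k) Q = τ j (τ k Q) := fun j k Q => by
    have : τ j (τ k Q) = (τ j * τ k) Q := rfl
    rw [this, τ, τ, τ, ← map_mul, ← zpow_add]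
  induction j using Int.induction_on with
  | zero => intro Q hQ; simpa [τ] using hQ
  | succ i ih => intro Q hQ; rw [hadd]; exact ih _ (h1 _ hQ)
  | pred i ih => intro Q hQ; rw [sub_eq_add_neg, hadd]; exact ih _ (h2 _ hQ)

theorem c_mem (j : ℤ) : c j ∈ carAlgebra := mem_generatedBy ⟨j, rfl⟩
theorem σx_mem (j : ℤ) : σx j ∈ spinAlgebra := mem_generatedBy (Or.inl (Or.inl ⟨j, trivial, rfl⟩))
theorem σy_mem (j : ℤ) : σy j ∈ spinAlgebra := mem_generatedBy (Or.inl (Or.inr ⟨j, trivial, rfl⟩))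
theorem σz_mem (j : ℤ) : σz j ∈ spinAlgebra := mem_generatedBy (Or.inr ⟨j, trivial, rfl⟩)

theorem conj_mem_car (u : unitary Op) (h : ∀ j, Unitary.conjStarAlgAut ℂ Op u (c j) ∈ carAlgebra) :
    ∀ Q ∈ carAlgebra, Unitary.conjStarAlgAut ℂ Op u Q ∈ carAlgebra :=
  conj_mem u inferInstance (by rintro _ ⟨j, rfl⟩; exact h j)

theorem conj_mem_spin (u : unitary Op)
    (hx : ∀ j, Unitary.conjStarAlgAut ℂ Op u (σx j) ∈ spinAlgebra)
    (hy : ∀ j, Unitary.conjStarAlgAut ℂ Op u (σy j) ∈ spinAlgebra)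
    (hz : ∀ j, Unitary.conjStarAlgAut ℂ Op u (σz j) ∈ spinAlgebra) :
    ∀ Q ∈ spinAlgebra, Unitary.conjStarAlgAut ℂ Op u Q ∈ spinAlgebra :=
  conj_mem u inferInstance (by
    rintro _ ((⟨j, -, rfl⟩ | ⟨j, -, rfl⟩) | ⟨j, -, rfl⟩)
    exacts [hx j, hy j, hz j])

theorem Θ_mem_car : ∀ Q ∈ carAlgebra, Θ Q ∈ carAlgebra :=
  conj_mem_car _ fun j => (Θ_c j).symm ▸ neg_mem (c_mem j)

theorem Θm_mem_car : ∀ Q ∈ carAlgebra, Θm Q ∈ carAlgebra :=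
  conj_mem_car _ fun j => (Θm_c j).symm ▸ carAlgebra.smul_mem (c_mem j) _

theorem τ_mem_car (j : ℤ) : ∀ Q ∈ carAlgebra, τ j Q ∈ carAlgebra :=
  τ_mem (conj_mem_car _ fun j => (τ_one_c j).symm ▸ c_mem _)
    (conj_mem_car _ fun j => by
      have := τ_neg_one (τ_one_c (j - 1))
      rw [sub_add_cancel] at this
      exact this.symm ▸ c_mem _) j

theorem Θ_mem_spin : ∀ Q ∈ spinAlgebra, Θ Q ∈ spinAlgebra :=
  conj_mem_spin _ (fun j => (Θ_σx j).symm ▸ neg_mem (σx_mem j))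
    (fun j => (Θ_σy j).symm ▸ neg_mem (σy_mem j)) (fun j => (Θ_σz j).symm ▸ σz_mem j)

theorem Θm_mem_spin : ∀ Q ∈ spinAlgebra, Θm Q ∈ spinAlgebra :=
  conj_mem_spin _ (fun j => (Θm_σx j).symm ▸ spinAlgebra.smul_mem (σx_mem j) _)
    (fun j => (Θm_σy j).symm ▸ spinAlgebra.smul_mem (σy_mem j) _)
    (fun j => (Θm_σz j).symm ▸ σz_mem j)

theorem τ_mem_spin (j : ℤ) : ∀ Q ∈ spinAlgebra, τ j Q ∈ spinAlgebra := by
  have key : ∀ f : ℤ → Op, (∀ j, τ 1 (f j) = f (j + 1)) → ∀ j, τ (-1) (f j) = f (j - 1) :=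
    fun f hf j => by
      have := τ_neg_one (hf (j - 1))
      rwa [sub_add_cancel] at this
  exact τ_mem (conj_mem_spin _ (fun j => (τ_one_σx j).symm ▸ σx_mem _)
      (fun j => (τ_one_σy j).symm ▸ σy_mem _) (fun j => (τ_one_σz j).symm ▸ σz_mem _))
    (conj_mem_spin _ (fun j => (key _ τ_one_σx j).symm ▸ σx_mem _)
      (fun j => (key _ τ_one_σy j).symm ▸ σy_mem _)
      (fun j => (key _ τ_one_σz j).symm ▸ σz_mem _)) j

/-- The `Θ`-fixed elements of a subalgebra. -/
def evenPart (A : StarSubalgebra ℂ Op) : StarSubalgebra ℂ Op :=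
  A ⊓ StarAlgHom.equalizer (Θ : Op →⋆ₐ[ℂ] Op) (StarAlgHom.id ℂ Op)

theorem mem_evenPart {A : StarSubalgebra ℂ Op} {Q : Op} :
    Q ∈ evenPart A ↔ Q ∈ A ∧ Θ Q = Q := Iff.rfl

instance (A : StarSubalgebra ℂ Op) [hA : IsClosed (A : Set Op)] :
    IsClosed (evenPart A : Set Op) :=
  hA.inter (isClosed_eq (continuous_conj parityOp) continuous_id)

theorem Θm_mem_even : ∀ Q ∈ evenPart carAlgebra, Θm Q ∈ evenPart carAlgebra := fun Q hQ => by
  refine ⟨Θm_mem_car Q hQ.1, ?_⟩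
  have h : Θ (Θm Q) = Θm (Θ Q) := by
    have h1 : Θ (Θm Q) = (Θ * Θm) Q := rfl
    have h2 : Θm (Θ Q) = (Θm * Θ) Q := rfl
    have h3 : parityOp * T = T * parityOp := Subtype.ext parity_mul_T
    rw [h1, h2, Θ, Θm, ← map_mul, ← map_mul, h3]
  change Θ (Θm Q) = Θm Q
  rw [h, (mem_evenPart.1 hQ).2]

theorem S_mem (n : ℤ) : S n ∈ spinAlgebra := by
  unfold S
  split_ifs <;> refine list_prod_mem ?_ <;> simp only [List.mem_map] <;>
    rintro _ ⟨k, -, rfl⟩ <;> exact σz_mem _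

theorem Θ_Θ (Q : Op) : Θ (Θ Q) = Q := by
  have h1 : Θ (Θ Q) = (Θ * Θ) Q := rfl
  have h3 : parityOp * parityOp = 1 := Subtype.ext (by
    have := Unitary.star_mul_self_of_mem parityOp.2
    rwa [star_parity] at this)
  rw [h1, Θ, ← map_mul, h3, map_one]; rfl

theorem T_mul (Q : Op) : (T : Op) * Q = Θm Q * T := by
  rw [Θm, Unitary.conjStarAlgAut_apply, star_T, mul_assoc, T_mul_T, mul_one]

theorem T_mul_c_mem (j : ℤ) : (T : Op) * c j ∈ spinAlgebra := by
  have hST : S j * T = T * S j := by rw [T_mul, fix_S Θm Θm_σz]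
  have h : (T : Op) * c j = (1 / 2 : ℂ) • (S j * (σx j + (-Complex.I) • σy j)) := by
    have h1 : σx j + (-Complex.I) • σy j = (2 : ℂ) • (T * S j * c j) := by
      rw [σx, σy, smul_smul, neg_mul, Complex.I_mul_I, neg_neg, one_smul, ← mul_add, two_smul,
        ← mul_add]
      congr 1; abel
    rw [h1, mul_smul_comm, smul_smul, ← mul_assoc, ← mul_assoc, hST, mul_assoc (T : Op),
      S_mul_self]
    norm_num
  rw [h]
  exact spinAlgebra.smul_mem (mul_mem (S_mem j) (add_mem (σx_mem j)
    (spinAlgebra.smul_mem (σy_mem j) _))) _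

/-- The elements of the form `Q₀ + Q₁` with `Q₀` even in the spin algebra, `Q₁` odd and
`T Q₁` in the spin algebra. -/
def splitAlgebra : StarSubalgebra ℂ Op where
  carrier := {Q | Q + Θ Q ∈ spinAlgebra ∧ T * (Q - Θ Q) ∈ spinAlgebra}
  mul_mem' := by
    rintro P Q ⟨hP0, hP1⟩ ⟨hQ0, hQ1⟩
    have e0 : P * Q + Θ (P * Q) = (1 / 2 : ℂ) • ((P + Θ P) * (Q + Θ Q) +
        Θm (T * (P - Θ P)) * (T * (Q - Θ Q))) := by
      have : Θm (T * (P - Θ P)) * (T * (Q - Θ Q)) = (P - Θ P) * (Q - Θ Q) := by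
        rw [← mul_assoc, ← T_mul, ← mul_assoc, T_mul_T, one_mul]
      rw [this, map_mul]
      have : (P + Θ P) * (Q + Θ Q) + (P - Θ P) * (Q - Θ Q) = (2 : ℂ) • (P * Q + Θ P * Θ Q) := by
        rw [two_smul]; noncomm_ring
      rw [this, smul_smul]; norm_num
    have e1 : T * (P * Q - Θ (P * Q)) = (1 / 2 : ℂ) • (Θm (P + Θ P) * (T * (Q - Θ Q)) +
        T * (P - Θ P) * (Q + Θ Q)) := by
      rw [← mul_assoc (Θm _), ← T_mul, map_mul]
      have : T * (P + Θ P) * (Q - Θ Q) + T * (P - Θ P) * (Q + Θ Q) =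
          (2 : ℂ) • (T * (P * Q - Θ P * Θ Q)) := by
        rw [two_smul]; noncomm_ring
      rw [this, smul_smul]; norm_num
    exact ⟨e0 ▸ spinAlgebra.smul_mem (add_mem (mul_mem hP0 hQ0)
        (mul_mem (Θm_mem_spin _ hP1) hQ1)) _,
      e1 ▸ spinAlgebra.smul_mem (add_mem (mul_mem (Θm_mem_spin _ hP0) hQ1)
        (mul_mem hP1 hQ0)) _⟩
  add_mem' := by
    rintro P Q ⟨hP0, hP1⟩ ⟨hQ0, hQ1⟩
    refine ⟨?_, ?_⟩
    · have := add_mem hP0 hQ0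
      rwa [show P + Q + Θ (P + Q) = P + Θ P + (Q + Θ Q) by rw [map_add]; abel]
    · have := add_mem hP1 hQ1
      rwa [show T * (P + Q - Θ (P + Q)) = T * (P - Θ P) + T * (Q - Θ Q) by
        rw [map_add]; noncomm_ring]
  algebraMap_mem' r := by
    have h : Θ (algebraMap ℂ Op r) = algebraMap ℂ Op r := by
      rw [Algebra.algebraMap_eq_smul_one, map_smul, map_one]
    refine ⟨?_, ?_⟩
    · rw [h]; exact add_mem (algebraMap_mem _ r) (algebraMap_mem _ r)
    · rw [h, sub_self, mul_zero]; exact zero_mem _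
  star_mem' := by
    rintro P ⟨hP0, hP1⟩
    refine ⟨?_, ?_⟩
    · have := star_mem hP0
      rwa [star_add, ← map_star] at this
    · have := Θm_mem_spin _ (star_mem hP1)
      rwa [star_mul, star_T, map_mul, Θm_T, ← T_mul, star_sub, ← map_star] at this

theorem car_le_split : carAlgebra ≤ splitAlgebra := by
  refine StarSubalgebra.topologicalClosure_minimal (StarAlgebra.adjoin_le ?_) ?_
  · rintro _ ⟨j, rfl⟩
    refine ⟨?_, ?_⟩
    · rw [Θ_c, add_neg_cancel]; exact zero_mem _
    · rw [Θ_c, sub_neg_eq_add, mul_add]; exact add_mem (T_mul_c_mem j) (T_mul_c_mem j)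
  · have hs : IsClosed (spinAlgebra : Set Op) := inferInstance
    have hc : Continuous Θ := continuous_conj parityOp
    exact (hs.preimage (continuous_id.add hc)).inter
      (hs.preimage (continuous_const.mul (continuous_id.sub hc)))

theorem even_car_le_spin : evenPart carAlgebra ≤ spinAlgebra := by
  rintro Q ⟨hQ, hΘ⟩
  have h := (car_le_split hQ).1
  have hΘ' : Θ Q = Q := hΘ
  rw [hΘ', ← two_smul ℂ] at h
  have := spinAlgebra.smul_mem h (1 / 2 : ℂ)
  rw [smul_smul] at this
  norm_num at this
  exact this

/-! The automorphisms restricted to the algebras on which states are considered -/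

/-- The restriction of an automorphism to an invariant subalgebra. -/
def restrictTo (α : Op ≃⋆ₐ[ℂ] Op) (A : StarSubalgebra ℂ Op) (h : ∀ Q ∈ A, α Q ∈ A) :
    A →⋆ₐ[ℂ] A :=
  ((α : Op →⋆ₐ[ℂ] Op).comp A.subtype).codRestrict A fun Q => h Q Q.2

/-- `Θ` on the CAR algebra. -/
def ΘCar : carAlgebra →⋆ₐ[ℂ] carAlgebra := restrictTo Θ carAlgebra Θ_mem_car

/-- `Θ_-` on the CAR algebra. -/
def ΘmCar : carAlgebra →⋆ₐ[ℂ] carAlgebra := restrictTo Θm carAlgebra Θm_mem_car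

/-- `Θ_-` on the even part of the CAR algebra. -/
def ΘmEven : evenPart carAlgebra →⋆ₐ[ℂ] evenPart carAlgebra :=
  restrictTo Θm (evenPart carAlgebra) Θm_mem_even

/-- The lattice translation `τ_j` of the CAR algebra. -/
def τCar (j : ℤ) : carAlgebra →⋆ₐ[ℂ] carAlgebra := restrictTo (τ j) carAlgebra (τ_mem_car j)

/-- `Θ` on the spin algebra. -/
def ΘSpin : spinAlgebra →⋆ₐ[ℂ] spinAlgebra := restrictTo Θ spinAlgebra Θ_mem_spin

/-- The lattice translation `τ_j` of the spin algebra. -/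
def τSpin (j : ℤ) : spinAlgebra →⋆ₐ[ℂ] spinAlgebra := restrictTo (τ j) spinAlgebra (τ_mem_spin j)

/-- The inclusion of the even part of the CAR algebra into the spin algebra. -/
def evenToSpin : evenPart carAlgebra →⋆ₐ[ℂ] spinAlgebra :=
  StarSubalgebra.inclusion even_car_le_spin

/-- The restriction `ψ_+` of a functional `ψ` on the CAR algebra to the even part. -/
def evenRestriction (ψ : carAlgebra →ₚ[ℂ] ℂ) : evenPart carAlgebra →ₚ[ℂ] ℂ :=
  pullback ψ (StarSubalgebra.inclusion (inf_le_left : evenPart carAlgebra ≤ carAlgebra))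

/-- `φ` is an extension to the spin algebra of the functional `ω` on the even part. -/
def IsExtension (φ : spinAlgebra →ₚ[ℂ] ℂ) (ω : evenPart carAlgebra →ₚ[ℂ] ℂ) : Prop :=
  pullback φ evenToSpin = ω

/-- `ψ ∘ τ_j = ψ` for all `j`. -/
def TranslationInvariantCar (ψ : carAlgebra →ₚ[ℂ] ℂ) : Prop :=
  ∀ j : ℤ, pullback ψ (τCar j) = ψ

/-- `φ ∘ τ_j = φ` for all `j`. -/
def TranslationInvariantSpin (φ : spinAlgebra →ₚ[ℂ] ℂ) : Prop :=
  ∀ j : ℤ, pullback φ (τSpin j) = φ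

/-- The von Neumann algebra `π_φ(M)''` for a subalgebra `M` of the spin algebra. -/
def spinBicommutant (φ : spinAlgebra →ₚ[ℂ] ℂ) (M : StarSubalgebra ℂ Op) :
    Set (φ.GNS →L[ℂ] φ.GNS) :=
  gnsBicommutant φ {Q : spinAlgebra | (Q : Op) ∈ M}

end JordanWigner

end

open JordanWigner

/-!
Let `E` be the common even part. The CAR algebra and the spin algebra are both generated by `E` and
an odd selfadjoint unitary: `c_1 + c_1^*` in the first case and `σ_x^{(1)} = T (c_1 + c_1^*)` in the
second. Conjugation by these unitaries gives involutions `β` and `Θ_- ∘ β` of `E`.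

For a pure state `ω` of `E` and an extension of `E` by an odd selfadjoint unitary that acts on `E`
by an involution `β'` there are two cases. If `π_ω` and `π_ω ∘ β'` are inequivalent, the even and
the odd vectors span disjoint representations of `E`, so the extension `ω ∘ P` of `ω` that vanishes
on odd elements is pure. If they are equivalent, Schur's lemma gives a selfadjoint unitary on the
GNS space that implements `β'`. It extends `π_ω` to the large algebra on the same space, and the
vector state of `Ω_ω` is a pure extension that is not `Θ`-invariant.

Apply this to `ω = ψ_+`. Purity of `ψ = ω ∘ P` rules out `ω ≅ ω ∘ β`. If `ω ≅ ω ∘ Θ_- ∘ β` then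
`ψ ≅ ψ ∘ Θ_-`, which excludes this equivalence in (i); in (ii) it would combine with `ω ≅ ω ∘ Θ_-`
to `ω ≅ ω ∘ β`. In (iii), `π_ψ` restricted to `E` contains only `ω` and `ω ∘ β`, so
`ω ∘ Θ_-`, which is not equivalent to `ω`, is equivalent to `ω ∘ β`.

In (iii), the implementer `V` of `τ_1` on `E` conjugates the implementer of `Θ_- ∘ β` to an
implementer of the translated automorphism, which determines `φ ∘ τ_1` on odd elements up to a
sign; hence `φ ∘ τ_2 = φ`. As `φ` is not `Θ`-invariant, some odd local `Q` has `φ(Q) ≠ 0`. The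
translates `τ_{2n}(Q)` commute with every local element eventually, so they converge weakly to the
scalar `φ(Q)`, inside either half chain. Each odd element `a` of a half chain is therefore
`φ(Q)⁻¹` times the weak limit of the even elements `a τ_{2n}(Q)`.
-/

noncomputable section

section Representations

variable {A B : Type*} [Ring A] [StarRing A] [Algebra ℂ A] [Ring B] [StarRing B] [Algebra ℂ B]
variable {H K M : Type*}
  [NormedAddCommGroup H] [InnerProductSpace ℂ H] [CompleteSpace H]
  [NormedAddCommGroup K] [InnerProductSpace ℂ K] [CompleteSpace K]
  [NormedAddCommGroup M] [InnerProductSpace ℂ M] [CompleteSpace M]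
  {π : A →⋆ₐ[ℂ] (H →L[ℂ] H)} {ρ : A →⋆ₐ[ℂ] (K →L[ℂ] K)} {σ : A →⋆ₐ[ℂ] (M →L[ℂ] M)}

/-- `X` intertwines the representations `π` and `ρ`. It is a mere function, so that the notion
applies to bounded operators, isometries and unitaries alike. -/
def IsIntertwiner (π : A →⋆ₐ[ℂ] (H →L[ℂ] H)) (ρ : A →⋆ₐ[ℂ] (K →L[ℂ] K)) (X : H → K) : Prop :=
  ∀ a ξ, X (π a ξ) = ρ a (X ξ)

/-- A representation is irreducible if its commutant consists of the scalars. -/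
def IsIrreducibleRep (π : A →⋆ₐ[ℂ] (H →L[ℂ] H)) : Prop :=
  ∀ Y : H →L[ℂ] H, IsIntertwiner π π Y → ∃ z : ℂ, Y = z • 1

/-- Unitary equivalence of representations; for GNS representations this is definitionally
`UnitarilyEquivalent`. -/
def RepEquiv (π : A →⋆ₐ[ℂ] (H →L[ℂ] H)) (ρ : A →⋆ₐ[ℂ] (K →L[ℂ] K)) : Prop :=
  ∃ U : H ≃ₗᵢ[ℂ] K, IsIntertwiner π ρ U

theorem rep_mul_apply (π : A →⋆ₐ[ℂ] (H →L[ℂ] H)) (a b : A) (ξ : H) :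
    π (a * b) ξ = π a (π b ξ) := by
  rw [map_mul, mul_apply_eq_comp]

theorem rep_one_apply (π : A →⋆ₐ[ℂ] (H →L[ℂ] H)) (ξ : H) : π 1 ξ = ξ := by
  rw [map_one, one_apply_eq_self]

theorem inner_rep_left (π : A →⋆ₐ[ℂ] (H →L[ℂ] H)) (a : A) (ξ η : H) :
    ⟪π a ξ, η⟫_ℂ = ⟪ξ, π (star a) η⟫_ℂ := by
  rw [map_star, ContinuousLinearMap.star_eq_adjoint, ContinuousLinearMap.adjoint_inner_right]

theorem inner_rep_right (π : A →⋆ₐ[ℂ] (H →L[ℂ] H)) (a : A) (ξ η : H) :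
    ⟪ξ, π a η⟫_ℂ = ⟪π (star a) ξ, η⟫_ℂ := by
  rw [inner_rep_left, star_star]

theorem inner_self_rep_apply (π : A →⋆ₐ[ℂ] (H →L[ℂ] H)) (a : A) (ξ : H) :
    ⟪π a ξ, π a ξ⟫_ℂ = ⟪ξ, π (star a * a) ξ⟫_ℂ := by
  rw [inner_rep_left, rep_mul_apply]

namespace IsIntertwiner

theorem comp {Y : K → M} {X : H → K} (hY : IsIntertwiner ρ σ Y) (hX : IsIntertwiner π ρ X) :
    IsIntertwiner π σ (Y ∘ X) := fun a ξ => by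
  rw [Function.comp_apply, hX, hY, Function.comp_apply]

theorem smul {X : H → K} (hX : IsIntertwiner π ρ X) (z : ℂ) : IsIntertwiner π ρ (z • X) :=
  fun a ξ => by rw [Pi.smul_apply, hX, Pi.smul_apply, map_smul]

theorem symm {U : H ≃ₗᵢ[ℂ] K} (hU : IsIntertwiner π ρ U) : IsIntertwiner ρ π U.symm := fun a η => by
  rw [LinearIsometryEquiv.symm_apply_eq, hU, LinearIsometryEquiv.apply_symm_apply]

theorem comp_hom {X : H → K} (hX : IsIntertwiner π ρ X) (α : B →⋆ₐ[ℂ] A) :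
    IsIntertwiner (π.comp α) (ρ.comp α) X := fun b => hX (α b)

theorem adjoint {X : H →L[ℂ] K} (hX : IsIntertwiner π ρ X) : IsIntertwiner ρ π X.adjoint :=
  fun a η => ext_inner_left ℂ fun ξ => by
    rw [ContinuousLinearMap.adjoint_inner_right, inner_rep_right, inner_rep_right,
      ContinuousLinearMap.adjoint_inner_right, hX]

end IsIntertwiner

namespace RepEquiv

theorem symm (h : RepEquiv π ρ) : RepEquiv ρ π :=
  let ⟨U, hU⟩ := h
  ⟨U.symm, hU.symm⟩

theorem trans (h : RepEquiv π ρ) (h' : RepEquiv ρ σ) : RepEquiv π σ :=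
  let ⟨U, hU⟩ := h
  let ⟨V, hV⟩ := h'
  ⟨U.trans V, hV.comp hU⟩

theorem comp (h : RepEquiv π ρ) (α : B →⋆ₐ[ℂ] A) : RepEquiv (π.comp α) (ρ.comp α) :=
  let ⟨U, hU⟩ := h
  ⟨U, hU.comp_hom α⟩

end RepEquiv

namespace IsIrreducibleRep

theorem of_repEquiv (hπ : IsIrreducibleRep π) (h : RepEquiv π ρ) : IsIrreducibleRep ρ := by
  obtain ⟨U, hU⟩ := h
  intro Y hY
  obtain ⟨z, hz⟩ := hπ ((U.symm : K →L[ℂ] H) ∘L Y ∘L (U : H →L[ℂ] K)) (hU.symm.comp (hY.comp hU))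
  refine ⟨z, ContinuousLinearMap.ext fun η => U.symm.injective ?_⟩
  simpa using congr($hz (U.symm η))

theorem comp_surjective (hπ : IsIrreducibleRep π) (α : B →⋆ₐ[ℂ] A) (hα : Function.Surjective α) :
    IsIrreducibleRep (π.comp α) := fun Y hY =>
  hπ Y fun a ξ => by
    obtain ⟨b, rfl⟩ := hα a
    exact hY b ξ

end IsIrreducibleRep

theorem norm_apply_eq_mul_of_adjoint_comp_self {X : H →L[ℂ] K} {z : ℂ} (hX : X ≠ 0)
    (hz : X.adjoint ∘L X = z • 1) : ∃ r : ℝ, 0 < r ∧ z = (r : ℂ) ^ 2 ∧ ∀ ξ, ‖X ξ‖ = r * ‖ξ‖ := by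
  have hsq (ξ : H) : (‖X ξ‖ : ℂ) ^ 2 = z * (‖ξ‖ : ℂ) ^ 2 := by
    have h : ⟪X ξ, X ξ⟫_ℂ = z * ⟪ξ, ξ⟫_ℂ := by
      rw [← ContinuousLinearMap.adjoint_inner_right, ← inner_smul_right]
      exact congr(⟪ξ, $hz ξ⟫_ℂ)
    rwa [inner_self_eq_norm_sq_to_K, inner_self_eq_norm_sq_to_K] at h
  obtain ⟨ξ₀, hξ₀⟩ : ∃ ξ, X ξ ≠ 0 := by
    by_contra! h
    exact hX (ContinuousLinearMap.ext h)
  have hξ₀' : ξ₀ ≠ 0 := fun h => hξ₀ (by rw [h, map_zero])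
  have hz' : z = ((‖X ξ₀‖ / ‖ξ₀‖ : ℝ) : ℂ) ^ 2 := by
    rw [Complex.ofReal_div, div_pow, hsq, mul_div_cancel_right₀]
    exact pow_ne_zero 2 (Complex.ofReal_ne_zero.2 (norm_ne_zero_iff.2 hξ₀'))
  refine ⟨‖X ξ₀‖ / ‖ξ₀‖, by positivity, hz', fun ξ => ?_⟩
  rw [← sq_eq_sq₀ (norm_nonneg _) (by positivity), mul_pow]
  exact_mod_cast hz' ▸ hsq ξ

theorem exists_linearIsometryEquiv_smul_of_adjoint_comp {X : H →L[ℂ] K} {z w : ℂ} (hX : X ≠ 0)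
    (hz : X.adjoint ∘L X = z • 1) (hw : X ∘L X.adjoint = w • 1) :
    ∃ (U : H ≃ₗᵢ[ℂ] K) (r : ℂ), ⇑U = r • ⇑X := by
  obtain ⟨r, hr, -, hnorm⟩ := norm_apply_eq_mul_of_adjoint_comp_self hX hz
  obtain ⟨s, hs, rfl, -⟩ := norm_apply_eq_mul_of_adjoint_comp_self (X := X.adjoint) (z := w)
    (fun h => hX (by simpa using congr(ContinuousLinearMap.adjoint $h)))
    (by rw [ContinuousLinearMap.adjoint_adjoint, hw])
  have hisom (ξ : H) : ‖((r : ℂ)⁻¹ • X) ξ‖ = ‖ξ‖ := by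
    rw [_root_.smul_apply, norm_smul, hnorm, norm_inv, Complex.norm_real,
      Real.norm_of_nonneg hr.le, inv_mul_cancel_left₀ hr.ne']
  refine ⟨.ofSurjective ⟨((r : ℂ)⁻¹ • X).toLinearMap, hisom⟩ fun η =>
    ⟨((r : ℂ) * ((s : ℂ) ^ 2)⁻¹) • X.adjoint η, ?_⟩, (r : ℂ)⁻¹, rfl⟩
  have hη : X (X.adjoint η) = (s : ℂ) ^ 2 • η := congr($hw η)
  change (r : ℂ)⁻¹ • X (((r : ℂ) * ((s : ℂ) ^ 2)⁻¹) • X.adjoint η) = η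
  have hr' : (r : ℂ) ≠ 0 := Complex.ofReal_ne_zero.2 hr.ne'
  have hs' : (s : ℂ) ^ 2 ≠ 0 := pow_ne_zero 2 (Complex.ofReal_ne_zero.2 hs.ne')
  rw [map_smul, hη, smul_smul, smul_smul, inv_mul_cancel_left₀ hr', inv_mul_cancel₀ hs', one_smul]

/-- **Schur's lemma**. -/
theorem RepEquiv.of_isIntertwiner (hπ : IsIrreducibleRep π) (hρ : IsIrreducibleRep ρ)
    {X : H →L[ℂ] K} (hX : IsIntertwiner π ρ X) (h0 : X ≠ 0) : RepEquiv π ρ := by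
  obtain ⟨z, hz⟩ := hπ (X.adjoint ∘L X) (hX.adjoint.comp hX)
  obtain ⟨w, hw⟩ := hρ (X ∘L X.adjoint) (hX.comp hX.adjoint)
  obtain ⟨U, r, hU⟩ := exists_linearIsometryEquiv_smul_of_adjoint_comp h0 hz hw
  exact ⟨U, hU ▸ hX.smul r⟩

theorem IsIntertwiner.eq_zero_of_not_repEquiv {X : H →L[ℂ] K} (hX : IsIntertwiner π ρ X)
    (hπ : IsIrreducibleRep π) (hρ : IsIrreducibleRep ρ) (h : ¬ RepEquiv π ρ) : X = 0 :=
  not_not.1 fun h0 => h (.of_isIntertwiner hπ hρ hX h0)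

/-- `Ω` is a cyclic vector of the representation `π`: the orbit `π(A)Ω` is dense. -/
def IsCyclicVector (π : A →⋆ₐ[ℂ] (H →L[ℂ] H)) (Ω : H) : Prop := DenseRange fun a => π a Ω

/-- The linear map `a ↦ π(a)ξ`. -/
def orbitMap (π : A →⋆ₐ[ℂ] (H →L[ℂ] H)) (ξ : H) : A →ₗ[ℂ] H where
  toFun a := π a ξ
  map_add' a b := by rw [map_add, _root_.add_apply]
  map_smul' z a := by rw [map_smul, _root_.smul_apply, RingHom.id_apply]

namespace IsCyclicVector

variable {Ω : H}

theorem eq_of_eq_on_orbit {X : Type*} [TopologicalSpace X] [T2Space X] (hΩ : IsCyclicVector π Ω)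
    {f g : H → X} (hf : Continuous f) (hg : Continuous g) (h : ∀ a, f (π a Ω) = g (π a Ω)) :
    f = g :=
  hΩ.equalizer hf hg (funext h)

theorem exists_isIntertwiner (hΩ : IsCyclicVector π Ω) {ξ : K} {C : ℝ}
    (hC : ∀ a, ‖ρ a ξ‖ ≤ C * ‖π a Ω‖) : ∃ V : H →L[ℂ] K, IsIntertwiner π ρ V ∧ V Ω = ξ := by
  let V : H →L[ℂ] K := (orbitMap ρ ξ).extendOfNorm (orbitMap π Ω)
  have hV (a : A) : V (π a Ω) = ρ a ξ :=
    LinearMap.extendOfNorm_eq (f := orbitMap ρ ξ) (e := orbitMap π Ω) hΩ ⟨C, hC⟩ a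
  refine ⟨V, fun a => congrFun (hΩ.eq_of_eq_on_orbit (by fun_prop) (by fun_prop) fun b => ?_), ?_⟩
  · rw [← rep_mul_apply, hV, hV, rep_mul_apply]
  · rw [← rep_one_apply π Ω, hV, rep_one_apply]

theorem exists_linearIsometry (hΩ : IsCyclicVector π Ω) {ξ : K}
    (h : ∀ a, ⟪Ω, π a Ω⟫_ℂ = ⟪ξ, ρ a ξ⟫_ℂ) :
    ∃ J : H →ₗᵢ[ℂ] K, IsIntertwiner π ρ J ∧ J Ω = ξ := by
  have hnorm (a : A) : ‖ρ a ξ‖ = ‖π a Ω‖ := by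
    rw [@norm_eq_sqrt_re_inner ℂ, @norm_eq_sqrt_re_inner ℂ, inner_self_rep_apply,
      inner_self_rep_apply, h]
  obtain ⟨V, hV, hVΩ⟩ := hΩ.exists_isIntertwiner (C := 1) fun a => by rw [hnorm, one_mul]
  have hVnorm : (fun η => ‖V η‖) = fun η => ‖η‖ :=
    hΩ.eq_of_eq_on_orbit (by fun_prop) (by fun_prop) fun a => by rw [hV, hVΩ, hnorm]
  exact ⟨⟨V.toLinearMap, congrFun hVnorm⟩, hV, hVΩ⟩

theorem exists_linearIsometryEquiv (hΩ : IsCyclicVector π Ω) {ξ : K} (hξ : IsCyclicVector ρ ξ)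
    (h : ∀ a, ⟪Ω, π a Ω⟫_ℂ = ⟪ξ, ρ a ξ⟫_ℂ) :
    ∃ U : H ≃ₗᵢ[ℂ] K, IsIntertwiner π ρ U ∧ U Ω = ξ := by
  obtain ⟨J, hJ, hJΩ⟩ := hΩ.exists_linearIsometry h
  have hdense : DenseRange J := hξ.mono (by
    rintro _ ⟨a, rfl⟩
    exact ⟨π a Ω, by rw [hJ, hJΩ]⟩)
  have hsurj : Function.Surjective J :=
    Set.range_eq_univ.1 (J.isometry.isClosedEmbedding.isClosed_range.closure_eq.symm.trans
      hdense.closure_range)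
  exact ⟨.ofSurjective J hsurj, hJ, hJΩ⟩

end IsCyclicVector

end Representations

section GNS

variable {A : Type*} [CStarAlgebra A] [PartialOrder A] [StarOrderedRing A]
variable {B : Type*} [CStarAlgebra B] [PartialOrder B] [StarOrderedRing B]

theorem gnsStarAlgHom_gnsVector (φ : A →ₚ[ℂ] ℂ) (a : A) :
    φ.gnsStarAlgHom a (gnsVector φ) = ((φ.toPreGNS a : φ.PreGNS) : φ.GNS) :=
  φ.gnsNonUnitalStarAlgHom_apply_coe.trans (by simp)

theorem isCyclicVector_gnsVector (φ : A →ₚ[ℂ] ℂ) :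
    IsCyclicVector φ.gnsStarAlgHom (gnsVector φ) := by
  simp only [IsCyclicVector, gnsStarAlgHom_gnsVector]
  exact UniformSpace.Completion.denseRange_coe.comp φ.toPreGNS.surjective.denseRange
    (UniformSpace.Completion.continuous_coe _)

theorem inner_gnsVector (φ : A →ₚ[ℂ] ℂ) (a : A) :
    ⟪gnsVector φ, φ.gnsStarAlgHom a (gnsVector φ)⟫_ℂ = φ a := by
  rw [gnsStarAlgHom_gnsVector, gnsVector, UniformSpace.Completion.inner_coe, φ.preGNS_inner_def]
  simp

theorem IsState.norm_gnsVector {φ : A →ₚ[ℂ] ℂ} (h : IsState φ) : ‖gnsVector φ‖ = 1 := by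
  have h1 := inner_gnsVector φ 1
  rw [rep_one_apply, show φ 1 = 1 from h] at h1
  rw [@norm_eq_sqrt_re_inner ℂ, h1, RCLike.one_re, Real.sqrt_one]

theorem IsState.nontrivial_gns {φ : A →ₚ[ℂ] ℂ} (h : IsState φ) : Nontrivial φ.GNS :=
  ⟨gnsVector φ, 0, norm_ne_zero_iff.1 (h.norm_gnsVector.symm ▸ one_ne_zero)⟩

theorem pullback_apply (φ : B →ₚ[ℂ] ℂ) (α : A →⋆ₐ[ℂ] B) (a : A) : pullback φ α a = φ (α a) := rfl

theorem IsState.pullback {φ : B →ₚ[ℂ] ℂ} (h : IsState φ) (α : A →⋆ₐ[ℂ] B) :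
    IsState (pullback φ α) := by
  rw [IsState, pullback_apply, map_one, h]

section

variable {H : Type*} [NormedAddCommGroup H] [InnerProductSpace ℂ H] [CompleteSpace H]
  {φ : A →ₚ[ℂ] ℂ} {π : A →⋆ₐ[ℂ] (H →L[ℂ] H)} {ξ : H}

theorem exists_gns_linearIsometry (h : ∀ a, φ a = ⟪ξ, π a ξ⟫_ℂ) :
    ∃ J : φ.GNS →ₗᵢ[ℂ] H, IsIntertwiner φ.gnsStarAlgHom π J ∧ J (gnsVector φ) = ξ :=
  (isCyclicVector_gnsVector φ).exists_linearIsometry fun a => by rw [inner_gnsVector, h]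

theorem exists_gns_linearIsometryEquiv (hξ : IsCyclicVector π ξ) (h : ∀ a, φ a = ⟪ξ, π a ξ⟫_ℂ) :
    ∃ U : φ.GNS ≃ₗᵢ[ℂ] H, IsIntertwiner φ.gnsStarAlgHom π U ∧ U (gnsVector φ) = ξ :=
  (isCyclicVector_gnsVector φ).exists_linearIsometryEquiv hξ fun a => by rw [inner_gnsVector, h]

theorem IsIrreducibleRep.repEquiv_of_vector (hφ : IsIrreducibleRep φ.gnsStarAlgHom)
    (hs : IsState φ) (hπ : IsIrreducibleRep π) (h : ∀ a, φ a = ⟪ξ, π a ξ⟫_ℂ) :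
    RepEquiv φ.gnsStarAlgHom π := by
  obtain ⟨J, hJ, -⟩ := exists_gns_linearIsometry h
  have := hs.nontrivial_gns
  refine .of_isIntertwiner hφ hπ (X := J.toContinuousLinearMap) hJ (norm_ne_zero_iff.1 ?_)
  rw [J.norm_toContinuousLinearMap]
  exact one_ne_zero

end

theorem repEquiv_pullback (φ : B →ₚ[ℂ] ℂ) {α : A →⋆ₐ[ℂ] B} (hα : Function.Surjective α) :
    RepEquiv (pullback φ α).gnsStarAlgHom (φ.gnsStarAlgHom.comp α) := by
  have hcont : Continuous fun b => φ.gnsStarAlgHom b (gnsVector φ) := by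
    have : Continuous φ.gnsStarAlgHom := map_continuous φ.gnsStarAlgHom
    fun_prop
  obtain ⟨U, hU, -⟩ := exists_gns_linearIsometryEquiv (φ := pullback φ α)
    (π := φ.gnsStarAlgHom.comp α) (ξ := gnsVector φ)
    ((isCyclicVector_gnsVector φ).comp hα.denseRange hcont)
    fun a => (inner_gnsVector φ (α a)).symm
  exact ⟨U, hU⟩

/-- The positive functional `a ↦ ⟨ξ, π(a)ξ⟩`, a state if `ξ` is a unit vector. -/
def vectorFunctional {H : Type*} [NormedAddCommGroup H] [InnerProductSpace ℂ H] [CompleteSpace H]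
    (π : A →⋆ₐ[ℂ] (H →L[ℂ] H)) (ξ : H) : A →ₚ[ℂ] ℂ :=
  .mk₀ ((innerSL ℂ ξ).toLinearMap ∘ₗ orbitMap π ξ) fun a ha => by
    obtain ⟨b, rfl⟩ := CStarAlgebra.nonneg_iff_eq_star_mul_self.1 ha
    change 0 ≤ ⟪ξ, π (star b * b) ξ⟫_ℂ
    rw [← inner_self_rep_apply, inner_self_eq_norm_sq_to_K]
    exact pow_nonneg (RCLike.ofReal_nonneg.2 (norm_nonneg _)) 2

theorem vectorFunctional_apply {H : Type*} [NormedAddCommGroup H] [InnerProductSpace ℂ H]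
    [CompleteSpace H] (π : A →⋆ₐ[ℂ] (H →L[ℂ] H)) (ξ : H) (a : A) :
    vectorFunctional π ξ a = ⟪ξ, π a ξ⟫_ℂ := rfl

end GNS

section PureStates

namespace IsIntertwiner

variable {A H : Type*} [Ring A] [StarRing A] [Algebra ℂ A]
  [NormedAddCommGroup H] [InnerProductSpace ℂ H] [CompleteSpace H]
  {π : A →⋆ₐ[ℂ] (H →L[ℂ] H)} {X Y : H →L[ℂ] H}

theorem add (hX : IsIntertwiner π π X) (hY : IsIntertwiner π π Y) :
    IsIntertwiner π π (X + Y : H →L[ℂ] H) := fun a ξ => by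
  rw [_root_.add_apply, hX, hY, _root_.add_apply, map_add]

theorem one_add_smul (hX : IsIntertwiner π π X) (z : ℂ) :
    IsIntertwiner π π (1 + z • X : H →L[ℂ] H) :=
  add (fun _ _ => rfl) (hX.smul z)

theorem sub_smul_one (hX : IsIntertwiner π π X) (z : ℂ) :
    IsIntertwiner π π (X - z • 1 : H →L[ℂ] H) := fun a ξ => by
  simp only [_root_.sub_apply, _root_.smul_apply, one_apply_eq_self, map_sub, map_smul, hX a ξ]

end IsIntertwiner

variable {A : Type*} [CStarAlgebra A] [PartialOrder A]

namespace IsPureState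

theorem isState {φ : A →ₚ[ℂ] ℂ} (h : IsPureState φ) : IsState φ := by
  obtain ⟨ω, hω, he⟩ := h.1
  rwa [PositiveLinearMap.toLinearMap_inj.1 he] at hω

theorem eq_of_convex {φ ω ω' : A →ₚ[ℂ] ℂ} (h : IsPureState φ) (hω : IsState ω)
    (hω' : IsState ω') {t : ℝ} (ht : 0 < t) (ht' : t < 1)
    (he : ∀ a, (t : ℂ) * ω a + (1 - t : ℂ) * ω' a = φ a) : ω = φ := by
  refine PositiveLinearMap.toLinearMap_inj.1 (h.2 ⟨ω, hω, rfl⟩ ⟨ω', hω', rfl⟩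
    ⟨t, 1 - t, ht, by linarith, by ring, LinearMap.ext fun a => ?_⟩)
  change t • ω a + (1 - t) • ω' a = φ a
  rw [Complex.real_smul, Complex.real_smul, ← he a, Complex.ofReal_sub, Complex.ofReal_one]

theorem of_convex {φ : A →ₚ[ℂ] ℂ} (h : IsState φ)
    (h' : ∀ ω ω' : A →ₚ[ℂ] ℂ, IsState ω → IsState ω' → ∀ t : ℝ, 0 < t → t < 1 →
      (∀ a, (t : ℂ) * ω a + (1 - t : ℂ) * ω' a = φ a) → ω = φ) : IsPureState φ := by
  refine ⟨⟨φ, h, rfl⟩, ?_⟩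
  rintro _ ⟨ω, hω, rfl⟩ _ ⟨ω', hω', rfl⟩ ⟨t, s, ht, hs, hts, he⟩
  obtain rfl : s = 1 - t := by linarith
  rw [h' ω ω' hω hω' t ht (by linarith) fun a => ?_]
  have ha : t • ω a + (1 - t) • ω' a = φ a := LinearMap.congr_fun he a
  rwa [Complex.real_smul, Complex.real_smul, Complex.ofReal_sub, Complex.ofReal_one] at ha

end IsPureState

variable [StarOrderedRing A]
variable {H : Type*} [NormedAddCommGroup H] [InnerProductSpace ℂ H] [CompleteSpace H]
variable {π : A →⋆ₐ[ℂ] (H →L[ℂ] H)} {Ω : H}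

/-- The positive functional `a ↦ ⟨ξ, D π(a) ξ⟩` defined by a positive operator `D` in the
commutant of `π`. -/
def commutantFunctional (π : A →⋆ₐ[ℂ] (H →L[ℂ] H)) (ξ : H) {D : H →L[ℂ] H}
    (hD : IsIntertwiner π π D) (h0 : 0 ≤ D) : A →ₚ[ℂ] ℂ :=
  .mk₀ ((innerSL ℂ ξ).toLinearMap ∘ₗ D.toLinearMap ∘ₗ orbitMap π ξ) fun a ha => by
    obtain ⟨b, rfl⟩ := CStarAlgebra.nonneg_iff_eq_star_mul_self.1 ha
    change 0 ≤ ⟪ξ, D (π (star b * b) ξ)⟫_ℂ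
    rw [rep_mul_apply, hD, ← inner_rep_left]
    exact ((ContinuousLinearMap.nonneg_iff_isPositive D).1 h0).inner_nonneg_right _

theorem one_add_nonneg_of_norm_le_one {Y : A} (hY : IsSelfAdjoint Y) (h1 : ‖Y‖ ≤ 1) :
    0 ≤ 1 + Y := by
  have h := (hY.neg_algebraMap_norm_le_self).trans' (neg_le_neg (algebraMap_mono A h1))
  rwa [map_one, neg_le_iff_add_nonneg'] at h

namespace IsPureState

variable {φ : A →ₚ[ℂ] ℂ}

theorem inner_commutant_eq_zero (h : IsPureState φ) (hφ : ∀ a, φ a = ⟪Ω, π a Ω⟫_ℂ)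
    {Y : H →L[ℂ] H} (hY : IsSelfAdjoint Y) (hc : IsIntertwiner π π Y)
    (h0 : ⟪Ω, Y Ω⟫_ℂ = 0) (a : A) : ⟪Ω, Y (π a Ω)⟫_ℂ = 0 := by
  let s : ℝ := (1 + ‖Y‖)⁻¹
  have hs : 0 < s := by positivity
  have hnonneg (ε : ℂ) (hε : IsSelfAdjoint ε) (hε' : ‖ε‖ = s) : 0 ≤ 1 + ε • Y := by
    refine one_add_nonneg_of_norm_le_one (hε.smul hY) ?_
    rw [norm_smul, hε', inv_mul_le_one₀ (by positivity)]
    linarith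
  have hself : IsSelfAdjoint (s : ℂ) := Complex.conj_ofReal s
  have hnorm : ‖(s : ℂ)‖ = s := Complex.norm_of_nonneg hs.le
  let ω := commutantFunctional π Ω (hc.one_add_smul s) (hnonneg s hself hnorm)
  let ω' := commutantFunctional π Ω (hc.one_add_smul (-s))
    (hnonneg (-s) hself.neg (by rw [norm_neg, hnorm]))
  have hω (b : A) : ω b = φ b + s * ⟪Ω, Y (π b Ω)⟫_ℂ := by
    rw [hφ, ← inner_smul_right, ← inner_add_right]
    rfl
  have hω' (b : A) : ω' b = φ b + -s * ⟪Ω, Y (π b Ω)⟫_ℂ := by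
    rw [hφ, ← inner_smul_right, ← inner_add_right]
    rfl
  have hone : ⟪Ω, Y (π 1 Ω)⟫_ℂ = 0 := by rwa [rep_one_apply]
  have hωφ : ω = φ := h.eq_of_convex (ω' := ω') (t := 1 / 2)
    (by rw [IsState, hω, hone, mul_zero, add_zero, h.isState])
    (by rw [IsState, hω', hone, mul_zero, add_zero, h.isState])
    (by norm_num) (by norm_num) fun b => by rw [hω, hω']; push_cast; ring
  have ha := hω a
  rw [hωφ, left_eq_add, mul_eq_zero] at ha
  exact ha.resolve_left (Complex.ofReal_ne_zero.2 hs.ne')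

theorem commutant_eq_zero (h : IsPureState φ) (hφ : ∀ a, φ a = ⟪Ω, π a Ω⟫_ℂ)
    (hΩ : IsCyclicVector π Ω) {Y : H →L[ℂ] H} (hY : IsSelfAdjoint Y) (hc : IsIntertwiner π π Y)
    (h0 : ⟪Ω, Y Ω⟫_ℂ = 0) : Y = 0 := by
  have horth : (fun η => ⟪Ω, Y η⟫_ℂ) = fun _ => 0 :=
    hΩ.eq_of_eq_on_orbit (by fun_prop) (by fun_prop) (h.inner_commutant_eq_zero hφ hY hc h0)
  have hYΩ : Y Ω = 0 := by
    rw [← inner_self_eq_zero (𝕜 := ℂ), ← ContinuousLinearMap.adjoint_inner_right,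
      ← ContinuousLinearMap.star_eq_adjoint, hY.star_eq]
    exact congrFun horth _
  exact DFunLike.coe_injective (hΩ.eq_of_eq_on_orbit Y.continuous continuous_const fun a => by
    rw [hc, hYΩ, map_zero, _root_.zero_apply])

theorem selfAdjoint_commutant_scalar (h : IsPureState φ) (hφ : ∀ a, φ a = ⟪Ω, π a Ω⟫_ℂ)
    (hΩ : IsCyclicVector π Ω) {Y : H →L[ℂ] H} (hY : IsSelfAdjoint Y)
    (hc : IsIntertwiner π π Y) : ∃ z : ℂ, Y = z • 1 := by
  have hΩ1 : ⟪Ω, Ω⟫_ℂ = 1 := by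
    rw [← h.isState, hφ, rep_one_apply]
  have hz : IsSelfAdjoint ⟪Ω, Y Ω⟫_ℂ := by
    rw [IsSelfAdjoint, RCLike.star_def, inner_conj_symm, ← ContinuousLinearMap.adjoint_inner_right,
      ← ContinuousLinearMap.star_eq_adjoint, hY.star_eq]
  refine ⟨⟪Ω, Y Ω⟫_ℂ, sub_eq_zero.1 (h.commutant_eq_zero hφ hΩ
    (hY.sub (hz.smul (IsSelfAdjoint.one _))) (hc.sub_smul_one _) ?_)⟩
  rw [_root_.sub_apply, _root_.smul_apply, one_apply_eq_self, inner_sub_right, inner_smul_right,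
    hΩ1, mul_one, sub_self]

theorem isIrreducibleRep (h : IsPureState φ) : IsIrreducibleRep φ.gnsStarAlgHom := by
  intro Y hY
  have hscalar {X : φ.GNS →L[ℂ] φ.GNS} (hX : IsSelfAdjoint X)
      (hc : IsIntertwiner φ.gnsStarAlgHom φ.gnsStarAlgHom X) : ∃ z : ℂ, X = z • 1 :=
    h.selfAdjoint_commutant_scalar (fun a => (inner_gnsVector φ a).symm)
      (isCyclicVector_gnsVector φ) hX hc
  have hYstar : IsIntertwiner φ.gnsStarAlgHom φ.gnsStarAlgHom
      (star Y : φ.GNS →L[ℂ] φ.GNS) := hY.adjoint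
  obtain ⟨z, hz⟩ := hscalar (IsSelfAdjoint.add_star_self Y) (hY.add hYstar)
  obtain ⟨w, hw⟩ := hscalar (X := Complex.I • Y + -Complex.I • star Y)
    (by simp [IsSelfAdjoint, add_comm])
    (IsIntertwiner.add (hY.smul Complex.I) (hYstar.smul (-Complex.I)))
  refine ⟨2⁻¹ * (z - Complex.I * w), ?_⟩
  have hY' : Y = (2⁻¹ : ℂ) • ((Y + star Y)
      - Complex.I • (Complex.I • Y + -Complex.I • star Y)) := by
    match_scalars <;> norm_num
  rw [hY', hz, hw]
  module

end IsPureState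

theorem IsIrreducibleRep.eq_smul_of_dominated {φ ω : A →ₚ[ℂ] ℂ}
    (hφ : IsIrreducibleRep φ.gnsStarAlgHom) {t : ℝ} (ht : 0 < t)
    (hle : ∀ a, (t : ℂ) * ω (star a * a) ≤ φ (star a * a)) : ∃ z : ℂ, ∀ a, ω a = z * φ a := by
  have hnorm (χ : A →ₚ[ℂ] ℂ) (a : A) :
      ((‖χ.gnsStarAlgHom a (gnsVector χ)‖ ^ 2 : ℝ) : ℂ) = χ (star a * a) := by
    rw [← inner_gnsVector, ← inner_self_rep_apply, inner_self_eq_norm_sq_to_K]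
    norm_cast
  obtain ⟨V, hV, hVΩ⟩ := (isCyclicVector_gnsVector φ).exists_isIntertwiner
    (ρ := ω.gnsStarAlgHom) (ξ := gnsVector ω) (C := √t⁻¹) fun a => by
      have h := hle a
      rw [← hnorm, ← hnorm, ← Complex.ofReal_mul, Complex.real_le_real] at h
      refine (sq_le_sq₀ (norm_nonneg _) (by positivity)).1 ?_
      rw [mul_pow, Real.sq_sqrt (by positivity)]
      exact (le_inv_mul_iff₀ ht).2 h
  obtain ⟨z, hz⟩ := hφ (V.adjoint ∘L V) (hV.adjoint.comp hV)
  refine ⟨z, fun a => ?_⟩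
  rw [← inner_gnsVector ω, ← hVΩ, ← hV, ← ContinuousLinearMap.adjoint_inner_right,
    ← inner_gnsVector φ, ← inner_smul_right]
  exact congr(⟪gnsVector φ, $hz (φ.gnsStarAlgHom a (gnsVector φ))⟫_ℂ)

theorem IsPureState.of_isIrreducibleRep {φ : A →ₚ[ℂ] ℂ} (h : IsState φ)
    (hi : IsIrreducibleRep φ.gnsStarAlgHom) : IsPureState φ := by
  refine .of_convex h fun ω ω' hω _ t ht ht' he => ?_
  obtain ⟨z, hz⟩ := hi.eq_smul_of_dominated (ω := ω) ht fun a =>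
    (le_add_of_nonneg_right (mul_nonneg (by exact_mod_cast sub_nonneg.2 ht'.le)
      (ω'.map_nonneg (star_mul_self_nonneg a)))).trans_eq (he _)
  have hz1 : 1 = z := by
    have h1 := hz 1
    rwa [show ω 1 = 1 from hω, show φ 1 = 1 from h, mul_one] at h1
  ext a
  rw [hz, ← hz1, one_mul]

end PureStates

section Implementer

variable {A : Type*} [Ring A] [StarRing A] [Algebra ℂ A]
variable {H : Type*} [NormedAddCommGroup H] [InnerProductSpace ℂ H] [CompleteSpace H]

/-- `W` is a selfadjoint unitary that implements the endomorphism `β` in the representation `π`. -/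
structure IsSelfAdjointImplementer (π : A →⋆ₐ[ℂ] (H →L[ℂ] H)) (β : A →⋆ₐ[ℂ] A)
    (W : H →L[ℂ] H) : Prop where
  star_eq : star W = W
  mul_self : W * W = 1
  mul_rep : ∀ a, W * π a = π (β a) * W

theorem star_eq_of_norm_apply_of_mul_self {W : H →L[ℂ] H} (hnorm : ∀ ξ, ‖W ξ‖ = ‖ξ‖)
    (hW : W * W = 1) : star W = W := by
  have h : star W * W = 1 := (ContinuousLinearMap.norm_map_iff_adjoint_comp_self W).1 hnorm
  rw [← mul_one (star W), ← hW, ← mul_assoc, h, one_mul]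

theorem exists_norm_eq_one_sq_mul_eq_one {z : ℂ} (hz : ‖z‖ = 1) :
    ∃ s : ℂ, ‖s‖ = 1 ∧ s ^ 2 * z = 1 := by
  obtain ⟨s, hs⟩ := IsAlgClosed.exists_pow_nat_eq z⁻¹ two_pos
  refine ⟨s, ?_, by rw [hs, inv_mul_cancel₀ (norm_ne_zero_iff.1 (hz ▸ one_ne_zero))]⟩
  rw [← pow_eq_one_iff_of_nonneg (norm_nonneg s) two_ne_zero, ← norm_pow, hs, norm_inv, hz, inv_one]

theorem IsIrreducibleRep.exists_isSelfAdjointImplementer [Nontrivial H]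
    {π : A →⋆ₐ[ℂ] (H →L[ℂ] H)} (hπ : IsIrreducibleRep π) {β : A →⋆ₐ[ℂ] A}
    (hβ : ∀ a, β (β a) = a) (h : RepEquiv π (π.comp β)) :
    ∃ W, IsSelfAdjointImplementer π β W := by
  obtain ⟨U, hU⟩ := h
  obtain ⟨z, hz⟩ := hπ ((U : H →L[ℂ] H) * (U : H →L[ℂ] H)) fun a ξ => by
    have h := (hU.comp_hom β).comp hU a ξ
    simpa [hβ] using h
  have hzU (ξ : H) : U (U ξ) = z • ξ := congr($hz ξ)
  have hnorm : ‖z‖ = 1 := by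
    obtain ⟨ξ, hξ⟩ := exists_ne (0 : H)
    have h := congr(‖$(hzU ξ)‖)
    rw [U.norm_map, U.norm_map, norm_smul] at h
    exact (mul_eq_right₀ (norm_ne_zero_iff.2 hξ)).1 h.symm
  obtain ⟨s, hs, hsz⟩ := exists_norm_eq_one_sq_mul_eq_one hnorm
  have hW : (s • (U : H →L[ℂ] H)) * (s • (U : H →L[ℂ] H)) = 1 := by
    rw [smul_mul_smul_comm, hz, smul_smul, ← sq, hsz, one_smul]
  refine ⟨s • (U : H →L[ℂ] H), star_eq_of_norm_apply_of_mul_self (fun ξ => ?_) hW, hW, fun a =>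
    ContinuousLinearMap.ext (hU.smul s a)⟩
  change ‖s • U ξ‖ = ‖ξ‖
  rw [norm_smul, hs, U.norm_map, one_mul]

end Implementer

/-- A `ℤ₂`-graded `C*`-algebra `B` with grading automorphism `θ` and even part `E`, generated by `E`
and an odd selfadjoint unitary `u`; `P` is the projection onto the even part and `β` the action of
`u` on `E` by conjugation. -/
structure GradedExtension (E B : Type*) [CStarAlgebra E] [PartialOrder E] [CStarAlgebra B]
    [PartialOrder B] where
  ι : E →⋆ₐ[ℂ] B
  θ : B →⋆ₐ[ℂ] B
  P : B →ₚ[ℂ] E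
  β : E →⋆ₐ[ℂ] E
  u : B
  P_ι : ∀ a, P (ι a) = a
  ι_P : ∀ b, (2 : ℂ) • ι (P b) = b + θ b
  θ_u : θ u = -u
  star_u : star u = u
  u_mul_u : u * u = 1
  ι_β : ∀ a, ι (β a) = u * ι a * u

namespace GradedExtension

variable {E B : Type*} [CStarAlgebra E] [PartialOrder E] [CStarAlgebra B] [PartialOrder B]
  (G : GradedExtension E B)

theorem ι_injective : Function.Injective G.ι := fun a b h => by
  rw [← G.P_ι a, h, G.P_ι]

theorem eq_of_two_smul_ι {a b : E} (h : (2 : ℂ) • G.ι a = (2 : ℂ) • G.ι b) : a = b :=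
  G.ι_injective (smul_right_injective B (two_ne_zero : (2 : ℂ) ≠ 0) h)

theorem θ_ι (a : E) : G.θ (G.ι a) = G.ι a := by
  have h := G.ι_P (G.ι a)
  rw [G.P_ι, two_smul] at h
  exact (add_left_cancel h).symm

theorem θ_θ (b : B) : G.θ (G.θ b) = b := by
  have h : G.θ (b + G.θ b) = b + G.θ b := by rw [← G.ι_P, map_smul, θ_ι]
  rw [map_add, add_comm b] at h
  exact add_left_cancel h

theorem P_θ (b : B) : G.P (G.θ b) = G.P b :=
  G.eq_of_two_smul_ι (by rw [G.ι_P, G.ι_P, θ_θ, add_comm])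

theorem P_odd {b : B} (hb : G.θ b = -b) : G.P b = 0 :=
  G.eq_of_two_smul_ι (by rw [G.ι_P, hb, add_neg_cancel, map_zero, smul_zero])

theorem θ_ι_mul_u (a : E) : G.θ (G.ι a * G.u) = -(G.ι a * G.u) := by
  rw [map_mul, G.θ_u, θ_ι, mul_neg]

theorem u_mul_ι (a : E) : G.u * G.ι a = G.ι (G.β a) * G.u := by
  rw [G.ι_β, mul_assoc, G.u_mul_u, mul_one]

theorem β_β (a : E) : G.β (G.β a) = a := by
  refine G.ι_injective ?_
  rw [G.ι_β, mul_assoc, ← u_mul_ι, ← mul_assoc, G.u_mul_u, one_mul]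

theorem β_surjective : Function.Surjective G.β := fun a => ⟨G.β a, G.β_β a⟩

theorem P_one : G.P 1 = 1 := by rw [← map_one G.ι, G.P_ι]

theorem P_conj (b : B) : G.P (G.u * b * G.u) = G.β (G.P b) := by
  refine G.eq_of_two_smul_ι ?_
  rw [G.ι_P, G.ι_β, ← smul_mul_assoc, ← mul_smul_comm, G.ι_P, map_mul, map_mul, G.θ_u]
  noncomm_ring

/-- The coefficient `b₁` in the decomposition `b = ι b₀ + ι b₁ * u`, in which `b₀ = P b`. -/
def oddCoeff (b : B) : E := G.P (b * G.u)

theorem ι_P_add_ι_oddCoeff_mul_u (b : B) : G.ι (G.P b) + G.ι (G.oddCoeff b) * G.u = b := by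
  refine smul_right_injective B (two_ne_zero : (2 : ℂ) ≠ 0) ?_
  change (2 : ℂ) • (_ + _) = (2 : ℂ) • b
  rw [smul_add, ← smul_mul_assoc, oddCoeff, G.ι_P, G.ι_P, map_mul, G.θ_u, add_mul, mul_neg, neg_mul,
    mul_assoc, mul_assoc, G.u_mul_u, two_smul]
  noncomm_ring

theorem P_ι_add (a c : E) : G.P (G.ι a + G.ι c * G.u) = a := by
  rw [map_add, G.P_ι, G.P_odd (G.θ_ι_mul_u c), add_zero]

theorem oddCoeff_ι_add (a c : E) : G.oddCoeff (G.ι a + G.ι c * G.u) = c := by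
  rw [oddCoeff, add_mul, mul_assoc, G.u_mul_u, mul_one, add_comm, P_ι_add]

theorem oddCoeff_ι (a : E) : G.oddCoeff (G.ι a) = 0 := by
  simpa using G.oddCoeff_ι_add a 0

theorem mul_eq (b c : B) :
    b * c = G.ι (G.P b * G.P c + G.oddCoeff b * G.β (G.oddCoeff c)) +
      G.ι (G.P b * G.oddCoeff c + G.oddCoeff b * G.β (G.P c)) * G.u := by
  have hu (a : E) (d : B) : G.u * (G.ι a * d) = G.ι (G.β a) * (G.u * d) := by
    rw [← mul_assoc, u_mul_ι, mul_assoc]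
  conv_lhs => rw [← G.ι_P_add_ι_oddCoeff_mul_u b, ← G.ι_P_add_ι_oddCoeff_mul_u c]
  simp only [map_add, map_mul, add_mul, mul_add, mul_assoc, hu, u_mul_ι, G.u_mul_u, mul_one]
  abel

theorem star_eq (b : B) :
    star b = G.ι (star (G.P b)) + G.ι (G.β (star (G.oddCoeff b))) * G.u := by
  conv_lhs => rw [← G.ι_P_add_ι_oddCoeff_mul_u b, star_add, star_mul, G.star_u, ← map_star G.ι,
    ← map_star G.ι, u_mul_ι]

section Representations

variable {H K M : Type*}
  [NormedAddCommGroup H] [InnerProductSpace ℂ H] [CompleteSpace H]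
  [NormedAddCommGroup K] [InnerProductSpace ℂ K] [CompleteSpace K]
  [NormedAddCommGroup M] [InnerProductSpace ℂ M] [CompleteSpace M]

theorem rep_apply (ρ : B →⋆ₐ[ℂ] (K →L[ℂ] K)) (b : B) (ξ : K) :
    ρ b ξ = ρ (G.ι (G.P b)) ξ + ρ (G.ι (G.oddCoeff b)) (ρ G.u ξ) := by
  conv_lhs => rw [← G.ι_P_add_ι_oddCoeff_mul_u b, map_add, _root_.add_apply, rep_mul_apply]

theorem rep_u_rep_u (ρ : B →⋆ₐ[ℂ] (K →L[ℂ] K)) (ξ : K) : ρ G.u (ρ G.u ξ) = ξ := by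
  rw [← rep_mul_apply, G.u_mul_u, rep_one_apply]

theorem isIntertwiner_u (ρ : B →⋆ₐ[ℂ] (K →L[ℂ] K)) :
    IsIntertwiner (ρ.comp G.ι) ((ρ.comp G.ι).comp G.β) (ρ G.u) := fun a ξ => by
  change ρ G.u (ρ (G.ι a) ξ) = ρ (G.ι (G.β a)) (ρ G.u ξ)
  rw [← rep_mul_apply, u_mul_ι, rep_mul_apply]

variable {π : E →⋆ₐ[ℂ] (H →L[ℂ] H)} {π' : E →⋆ₐ[ℂ] (M →L[ℂ] M)} {ρ : B →⋆ₐ[ℂ] (K →L[ℂ] K)}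

theorem isIntertwiner_adjoint_comp_u_comp {J : H →L[ℂ] K} (hJ : IsIntertwiner π (ρ.comp G.ι) J)
    {J' : M →L[ℂ] K} (hJ' : IsIntertwiner π' (ρ.comp G.ι) J') :
    IsIntertwiner π (π'.comp G.β) (J'.adjoint ∘L ρ G.u ∘L J) :=
  (hJ'.adjoint.comp_hom G.β).comp ((G.isIntertwiner_u ρ).comp hJ)

theorem inner_linearIsometry_rep (hπ : IsIrreducibleRep π) (hne : ¬ RepEquiv π (π.comp G.β))
    (J : H →ₗᵢ[ℂ] K) (hJ : IsIntertwiner π (ρ.comp G.ι) J) (b : B) (ξ η : H) :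
    ⟪J ξ, ρ b (J η)⟫_ℂ = ⟪ξ, π (G.P b) η⟫_ℂ := by
  let J₀ : H →L[ℂ] K := J.toContinuousLinearMap
  have hodd : J₀.adjoint ∘L ρ G.u ∘L J₀ = 0 :=
    (G.isIntertwiner_adjoint_comp_u_comp hJ hJ).eq_zero_of_not_repEquiv hπ
      (hπ.comp_surjective G.β G.β_surjective) hne
  have hJι (a : E) (ζ : H) : ρ (G.ι a) (J ζ) = J (π a ζ) := (hJ a ζ).symm
  have horth (ζ : H) : ⟪J ζ, ρ G.u (J η)⟫_ℂ = 0 := by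
    have h : J₀.adjoint (ρ G.u (J η)) = 0 := congr($hodd η)
    rw [← inner_zero_right ζ, ← h]
    exact (ContinuousLinearMap.adjoint_inner_right J₀ ζ _).symm
  rw [G.rep_apply, inner_add_right, hJι, J.inner_map_map, inner_rep_right _ (G.ι _), ← map_star G.ι,
    hJι, horth, add_zero]

theorem repEquiv_or_repEquiv_comp_β (hπ : IsIrreducibleRep π) (hπ' : IsIrreducibleRep π')
    {J : H →L[ℂ] K} (hJ : IsIntertwiner π (ρ.comp G.ι) J)
    {J' : M →L[ℂ] K} (hJ' : IsIntertwiner π' (ρ.comp G.ι) J') (h0 : J' ≠ 0)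
    {Ω : H} (hΩ : IsCyclicVector ρ (J Ω)) :
    RepEquiv π π' ∨ RepEquiv π (π'.comp G.β) := by
  by_contra! h
  have heven : J'.adjoint ∘L J = 0 :=
    IsIntertwiner.eq_zero_of_not_repEquiv (hJ'.adjoint.comp hJ) hπ hπ' h.1
  have hodd : J'.adjoint ∘L ρ G.u ∘L J = 0 :=
    (G.isIntertwiner_adjoint_comp_u_comp hJ hJ').eq_zero_of_not_repEquiv hπ
      (hπ'.comp_surjective G.β G.β_surjective) h.2
  have hadj (a : E) (ξ : K) : J'.adjoint (ρ (G.ι a) ξ) = π' a (J'.adjoint ξ) := hJ'.adjoint a ξ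
  have hzero : ⇑J'.adjoint = fun _ => 0 :=
    hΩ.eq_of_eq_on_orbit J'.adjoint.continuous continuous_const fun b => by
      rw [G.rep_apply, map_add, hadj, hadj, show J'.adjoint (J Ω) = 0 from congr($heven Ω),
        show J'.adjoint (ρ G.u (J Ω)) = 0 from congr($hodd Ω), map_zero, map_zero, add_zero]
  have hadj0 : J'.adjoint = 0 := DFunLike.coe_injective hzero
  exact h0 (by rw [← ContinuousLinearMap.adjoint_adjoint J', hadj0, map_zero])

/-- The representation of `B` on the space of `π` in which `u` acts as the implementer `W`. -/
def crossedRep {W : H →L[ℂ] H} (hW : IsSelfAdjointImplementer π G.β W) :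
    B →⋆ₐ[ℂ] (H →L[ℂ] H) where
  toFun b := π (G.P b) + π (G.oddCoeff b) * W
  map_one' := by
    rw [← map_one G.ι, G.P_ι, oddCoeff_ι, map_one, map_zero, zero_mul, add_zero]
  map_mul' b c := by
    have hWπ (a : E) (Y : H →L[ℂ] H) : W * (π a * Y) = π (G.β a) * (W * Y) := by
      rw [← mul_assoc, hW.mul_rep, mul_assoc]
    rw [G.mul_eq b c, P_ι_add, oddCoeff_ι_add]
    simp only [map_add, map_mul, add_mul, mul_add, mul_assoc, hWπ, hW.mul_rep, hW.mul_self, mul_one]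
    abel
  map_zero' := by rw [← map_zero G.ι, G.P_ι, oddCoeff_ι, map_zero, zero_mul, add_zero]
  map_add' b c := by
    simp only [oddCoeff, add_mul, map_add]
    abel
  commutes' r := by
    rw [← AlgHomClass.commutes G.ι r, G.P_ι, oddCoeff_ι, map_zero, zero_mul, add_zero,
      AlgHomClass.commutes π r]
  map_star' b := by
    rw [G.star_eq b, P_ι_add, oddCoeff_ι_add, star_add, star_mul, hW.star_eq, ← map_star π,
      ← map_star π, hW.mul_rep]

theorem crossedRep_comp_ι {W : H →L[ℂ] H} (hW : IsSelfAdjointImplementer π G.β W) :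
    (G.crossedRep hW).comp G.ι = π := by
  ext1 a
  change π (G.P (G.ι a)) + π (G.oddCoeff (G.ι a)) * W = π a
  rw [G.P_ι, oddCoeff_ι, map_zero, zero_mul, add_zero]

theorem exists_rep_comp_ι_eq [Nontrivial H] (hπ : IsIrreducibleRep π)
    (h : RepEquiv π (π.comp G.β)) : ∃ ρ : B →⋆ₐ[ℂ] (H →L[ℂ] H), ρ.comp G.ι = π :=
  let ⟨_, hW⟩ := hπ.exists_isSelfAdjointImplementer G.β_β h
  ⟨G.crossedRep hW, G.crossedRep_comp_ι hW⟩

theorem exists_sign_odd_of_isIntertwiner [Nontrivial K] (hρ : IsIrreducibleRep (ρ.comp G.ι))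
    {τ : B →⋆ₐ[ℂ] B} {τE : E →⋆ₐ[ℂ] E} (hτ : ∀ a, τ (G.ι a) = G.ι (τE a)) (V : K ≃ₗᵢ[ℂ] K)
    (hV : IsIntertwiner (ρ.comp G.ι) ((ρ.comp G.ι).comp τE) V) :
    ∃ z : ℂ, z * z = 1 ∧ ∀ b, G.θ b = -b → ∀ ξ, ρ (τ b) (V ξ) = z • V (ρ b ξ) := by
  let X : K →L[ℂ] K := (V.symm : K →L[ℂ] K) ∘L ρ (τ G.u) ∘L (V : K →L[ℂ] K)
  have hVX (ξ : K) : V (X ξ) = ρ (τ G.u) (V ξ) := V.apply_symm_apply _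
  have hVι (a : E) (ξ : K) : V (ρ (G.ι a) ξ) = ρ (τ (G.ι a)) (V ξ) := by
    rw [hτ]
    exact hV a ξ
  have hX : IsIntertwiner (ρ.comp G.ι) ((ρ.comp G.ι).comp G.β) X := fun a ξ => V.injective <| by
    change V (X (ρ (G.ι a) ξ)) = V (ρ (G.ι (G.β a)) (X ξ))
    rw [hVX, hVι, hVι, hVX, ← rep_mul_apply, ← rep_mul_apply, ← map_mul, ← map_mul, u_mul_ι]
  have hXX (ξ : K) : X (X ξ) = ξ := V.injective <| by
    rw [hVX, hVX, ← rep_mul_apply, ← map_mul, G.u_mul_u, map_one, rep_one_apply]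
  obtain ⟨z, hz⟩ := hρ (ρ G.u * X) fun a ξ => by
    have h := ((G.isIntertwiner_u ρ).comp_hom G.β).comp hX a ξ
    simpa [G.β_β] using h
  have hXz (ξ : K) : X ξ = z • ρ G.u ξ := by
    have h : ρ G.u (X ξ) = z • ξ := congr($hz ξ)
    rw [← G.rep_u_rep_u ρ (X ξ), h, map_smul]
  refine ⟨z, ?_, fun b hb ξ => ?_⟩
  · obtain ⟨ξ, hξ⟩ := exists_ne (0 : K)
    have h := hXX ξ
    rw [hXz, hXz, map_smul, rep_u_rep_u, smul_smul] at h
    exact smul_left_injective ℂ hξ (h.trans (one_smul ℂ ξ).symm)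
  · obtain ⟨a, rfl⟩ : ∃ a, b = G.ι a * G.u := by
      refine ⟨G.oddCoeff b, ?_⟩
      conv_lhs => rw [← G.ι_P_add_ι_oddCoeff_mul_u b, G.P_odd hb, map_zero, zero_add]
    rw [map_mul τ, rep_mul_apply, ← hVX, ← hVι, hXz, map_smul, map_smul, rep_mul_apply]

end Representations

end GradedExtension

theorem repEquiv_comp_of_unitarilyEquivalent {A : Type*} [CStarAlgebra A] [PartialOrder A]
    [StarOrderedRing A] {ω : A →ₚ[ℂ] ℂ} {α β : A →⋆ₐ[ℂ] A} (hα : Function.Surjective α)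
    (h : UnitarilyEquivalent ω (pullback ω α))
    (h' : RepEquiv ω.gnsStarAlgHom (ω.gnsStarAlgHom.comp (α.comp β))) :
    RepEquiv ω.gnsStarAlgHom (ω.gnsStarAlgHom.comp β) :=
  h'.trans ((RepEquiv.trans h (repEquiv_pullback ω hα)).comp β).symm

namespace GradedExtension

section InvariantExtension

variable {E B : Type*} [CStarAlgebra E] [PartialOrder E] [CStarAlgebra B] [PartialOrder B]
  (G : GradedExtension E B) {φ : B →ₚ[ℂ] ℂ} {ω : E →ₚ[ℂ] ℂ}

theorem isState_comp_P (h : IsState ω) : IsState (ω.comp G.P) := by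
  change ω (G.P 1) = 1
  rw [G.P_one, h]

variable [StarOrderedRing B]

theorem pullback_comp_P_θ (ω : E →ₚ[ℂ] ℂ) : pullback (ω.comp G.P) G.θ = ω.comp G.P :=
  PositiveLinearMap.ext fun b => congrArg ω (G.P_θ b)

variable [StarOrderedRing E]

theorem pullback_comp_P_ι (ω : E →ₚ[ℂ] ℂ) : pullback (ω.comp G.P) G.ι = ω :=
  PositiveLinearMap.ext fun a => congrArg ω (G.P_ι a)

theorem apply_add_apply_θ (hω : pullback φ G.ι = ω) (b : B) : φ b + φ (G.θ b) = 2 * ω (G.P b) := by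
  rw [← hω, pullback_apply, ← smul_eq_mul, ← map_smul, G.ι_P, map_add]

theorem eq_comp_P (hφ : pullback φ G.θ = φ) (hω : pullback φ G.ι = ω) : φ = ω.comp G.P := by
  ext b
  have h := G.apply_add_apply_θ hω b
  rw [← pullback_apply, hφ] at h
  change φ b = ω (G.P b)
  linear_combination h / 2

theorem isPureState_of_comp_P (h : IsPureState (ω.comp G.P)) : IsPureState ω := by
  have hω : IsState ω := G.pullback_comp_P_ι ω ▸ h.isState.pullback G.ι
  refine .of_convex hω fun ω₁ ω₂ h₁ h₂ t ht ht' he => ?_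
  have heq := h.eq_of_convex (G.isState_comp_P h₁) (G.isState_comp_P h₂) ht ht' fun b => he (G.P b)
  rw [← G.pullback_comp_P_ι ω₁, heq, pullback_comp_P_ι]

theorem exists_gns_isIntertwiner_ι (hω : pullback φ G.ι = ω) :
    ∃ J : ω.GNS →ₗᵢ[ℂ] φ.GNS,
      IsIntertwiner ω.gnsStarAlgHom (φ.gnsStarAlgHom.comp G.ι) J ∧
        J (gnsVector ω) = gnsVector φ :=
  exists_gns_linearIsometry fun a => by
    rw [← hω, pullback_apply, ← inner_gnsVector φ]
    rfl

theorem eq_comp_P_of_not_repEquiv (hω : pullback φ G.ι = ω)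
    (hi : IsIrreducibleRep ω.gnsStarAlgHom)
    (hne : ¬ RepEquiv ω.gnsStarAlgHom (ω.gnsStarAlgHom.comp G.β)) : φ = ω.comp G.P := by
  obtain ⟨J, hJ, hJΩ⟩ := G.exists_gns_isIntertwiner_ι hω
  ext b
  rw [← inner_gnsVector φ, ← hJΩ, G.inner_linearIsometry_rep hi hne J hJ, inner_gnsVector]
  rfl

theorem isPureState_comp_P (hp : IsPureState ω)
    (hne : ¬ RepEquiv ω.gnsStarAlgHom (ω.gnsStarAlgHom.comp G.β)) :
    IsPureState (ω.comp G.P) := by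
  refine .of_convex (G.isState_comp_P hp.isState) fun φ₁ φ₂ h₁ h₂ t ht ht' he => ?_
  refine G.eq_comp_P_of_not_repEquiv ?_ hp.isIrreducibleRep hne
  refine hp.eq_of_convex (h₁.pullback G.ι) (h₂.pullback G.ι) ht ht' fun a => (he (G.ι a)).trans ?_
  exact congrArg ω (G.P_ι a)

theorem unitarilyEquivalent_comp_P (hψ : IsPureState (ω.comp G.P))
    (hne : ¬ RepEquiv ω.gnsStarAlgHom (ω.gnsStarAlgHom.comp G.β)) {α : B →⋆ₐ[ℂ] B}
    (hα : Function.Surjective α) {αE : E →⋆ₐ[ℂ] E} (hαP : ∀ b, G.P (α b) = αE (G.P b))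
    (h : RepEquiv ω.gnsStarAlgHom (ω.gnsStarAlgHom.comp (αE.comp G.β))) :
    UnitarilyEquivalent (ω.comp G.P) (pullback (ω.comp G.P) α) := by
  set ψ := ω.comp G.P
  have hirr : IsIrreducibleRep (pullback ψ α).gnsStarAlgHom :=
    (hψ.isIrreducibleRep.comp_surjective α hα).of_repEquiv (repEquiv_pullback ψ hα).symm
  obtain ⟨J, hJ, -⟩ := G.exists_gns_isIntertwiner_ι (φ := ψ) (G.pullback_comp_P_ι ω)
  obtain ⟨U, hU⟩ := h
  obtain ⟨ξ, hξ⟩ := U.surjective (gnsVector ω)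
  have hvec (b : B) : pullback ψ α b =
      ⟪ψ.gnsStarAlgHom G.u (J ξ), ψ.gnsStarAlgHom b (ψ.gnsStarAlgHom G.u (J ξ))⟫_ℂ := by
    symm
    calc ⟪ψ.gnsStarAlgHom G.u (J ξ), ψ.gnsStarAlgHom b (ψ.gnsStarAlgHom G.u (J ξ))⟫_ℂ
        = ⟪J ξ, ψ.gnsStarAlgHom (G.u * b * G.u) (J ξ)⟫_ℂ := by
          rw [inner_rep_left, G.star_u, rep_mul_apply, rep_mul_apply]
      _ = ⟪ξ, ω.gnsStarAlgHom (G.β (G.P b)) ξ⟫_ℂ := by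
          rw [G.inner_linearIsometry_rep (G.isPureState_of_comp_P hψ).isIrreducibleRep hne J hJ,
            G.P_conj]
      _ = ⟪gnsVector ω, ω.gnsStarAlgHom (αE (G.β (G.β (G.P b)))) (gnsVector ω)⟫_ℂ := by
          rw [← U.inner_map_map, hU, hξ]
          rfl
      _ = ω (G.P (α b)) := by rw [G.β_β, inner_gnsVector, hαP]
  exact (hirr.repEquiv_of_vector (hψ.isState.pullback α) hψ.isIrreducibleRep hvec).symm

theorem repEquiv_of_unitarilyEquivalent (hp : IsPureState ω) (hω : pullback φ G.ι = ω)
    {α : B →⋆ₐ[ℂ] B} {αE : E →⋆ₐ[ℂ] E} (hαE : Function.Surjective αE)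
    (hα : ∀ a, α (G.ι a) = G.ι (αE a)) (h : UnitarilyEquivalent φ (pullback φ α))
    (hne : ¬ UnitarilyEquivalent ω (pullback ω αE)) :
    RepEquiv ω.gnsStarAlgHom (ω.gnsStarAlgHom.comp (αE.comp G.β)) := by
  obtain ⟨U, hU⟩ := h
  obtain ⟨J, hJ, hJΩ⟩ := G.exists_gns_isIntertwiner_ι hω
  have hequiv := repEquiv_pullback ω hαE
  have hirr : IsIrreducibleRep (pullback ω αE).gnsStarAlgHom :=
    (hp.isIrreducibleRep.comp_surjective αE hαE).of_repEquiv hequiv.symm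
  have hstate := hp.isState.pullback αE
  obtain ⟨η, hη⟩ := U.surjective (gnsVector (pullback φ α))
  obtain ⟨J', hJ', -⟩ := exists_gns_linearIsometry (φ := pullback ω αE)
    (π := φ.gnsStarAlgHom.comp G.ι) (ξ := η) fun a => by
      change _ = ⟪η, φ.gnsStarAlgHom (G.ι a) η⟫_ℂ
      rw [← U.inner_map_map, hU, hη, inner_gnsVector, pullback_apply, pullback_apply, hα, ← hω,
        pullback_apply]
  have hJ'0 : J'.toContinuousLinearMap ≠ 0 := by
    have := hstate.nontrivial_gns
    exact norm_ne_zero_iff.1 (J'.norm_toContinuousLinearMap.symm ▸ one_ne_zero)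
  rcases G.repEquiv_or_repEquiv_comp_β hp.isIrreducibleRep hirr (J := J.toContinuousLinearMap) hJ
    (J' := J'.toContinuousLinearMap) hJ' hJ'0 (hJΩ ▸ isCyclicVector_gnsVector φ) with h' | h'
  · exact absurd h' hne
  · exact h'.trans (hequiv.comp G.β)

end InvariantExtension

section SameSpace

variable {E B : Type*} [CStarAlgebra E] [PartialOrder E] [StarOrderedRing E]
  [CStarAlgebra B] [PartialOrder B] (G : GradedExtension E B) {ω : E →ₚ[ℂ] ℂ}
  {ρ : B →⋆ₐ[ℂ] (ω.GNS →L[ℂ] ω.GNS)}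

theorem rep_ι_apply (hρ : ρ.comp G.ι = ω.gnsStarAlgHom) (a : E) (ξ : ω.GNS) :
    ρ (G.ι a) ξ = ω.gnsStarAlgHom a ξ := congr($hρ a ξ)

variable [StarOrderedRing B]

theorem pullback_vectorFunctional_ι (hρ : ρ.comp G.ι = ω.gnsStarAlgHom) :
    pullback (vectorFunctional ρ (gnsVector ω)) G.ι = ω := by
  ext a
  rw [pullback_apply, vectorFunctional_apply, G.rep_ι_apply hρ, inner_gnsVector]

theorem isState_vectorFunctional (hρ : ρ.comp G.ι = ω.gnsStarAlgHom) (hω : IsState ω) :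
    IsState (vectorFunctional ρ (gnsVector ω)) := by
  rw [IsState, ← map_one G.ι, ← pullback_apply, G.pullback_vectorFunctional_ι hρ, hω]

theorem exists_gns_vectorFunctional_equiv (hρ : ρ.comp G.ι = ω.gnsStarAlgHom) :
    ∃ U : ω.GNS ≃ₗᵢ[ℂ] (vectorFunctional ρ (gnsVector ω)).GNS,
      U (gnsVector ω) = gnsVector (vectorFunctional ρ (gnsVector ω)) ∧
        IsIntertwiner ω.gnsStarAlgHom
          ((vectorFunctional ρ (gnsVector ω)).gnsStarAlgHom.comp G.ι) U := by
  have hcyc : IsCyclicVector ρ (gnsVector ω) := (isCyclicVector_gnsVector ω).mono (by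
    rintro _ ⟨a, rfl⟩
    exact ⟨G.ι a, G.rep_ι_apply hρ a _⟩)
  obtain ⟨U, hU, hUΩ⟩ := exists_gns_linearIsometryEquiv hcyc (vectorFunctional_apply ρ _)
  refine ⟨U.symm, U.symm_apply_eq.2 hUΩ.symm, ?_⟩
  simpa only [hρ] using hU.symm.comp_hom G.ι

theorem pullback_θ_vectorFunctional_ne (hρ : ρ.comp G.ι = ω.gnsStarAlgHom) (hω : IsState ω) :
    pullback (vectorFunctional ρ (gnsVector ω)) G.θ ≠ vectorFunctional ρ (gnsVector ω) := by
  intro hθ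
  set Ω := gnsVector ω
  have hodd (a : E) : ⟪ρ G.u Ω, ω.gnsStarAlgHom a Ω⟫_ℂ = 0 := by
    have h := congr($hθ (G.ι (star a) * G.u))
    rw [pullback_apply, θ_ι_mul_u, map_neg, neg_eq_self, vectorFunctional_apply, rep_mul_apply,
      inner_rep_right, ← map_star, star_star, G.rep_ι_apply hρ] at h
    rw [← inner_conj_symm, h, map_zero]
  have horth : (fun η => ⟪ρ G.u Ω, η⟫_ℂ) = fun _ => 0 :=
    (isCyclicVector_gnsVector ω).eq_of_eq_on_orbit (by fun_prop) (by fun_prop) hodd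
  have hu : ρ G.u Ω = 0 := inner_self_eq_zero.1 (congrFun horth _)
  have hΩ : Ω = 0 := by rw [← G.rep_u_rep_u ρ Ω, hu, map_zero]
  exact one_ne_zero (hω.norm_gnsVector.symm.trans (norm_eq_zero.2 hΩ))

theorem not_repEquiv_of_isPureState_comp_P (h : IsPureState (ω.comp G.P)) :
    ¬ RepEquiv ω.gnsStarAlgHom (ω.gnsStarAlgHom.comp G.β) := fun he => by
  have hp := G.isPureState_of_comp_P h
  have := hp.isState.nontrivial_gns
  obtain ⟨ρ, hρ⟩ := G.exists_rep_comp_ι_eq hp.isIrreducibleRep he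
  have hs := G.isState_vectorFunctional hρ hp.isState
  -- `ω ∘ P` is the average of the extension and its image under `θ`.
  have heq : vectorFunctional ρ (gnsVector ω) = ω.comp G.P :=
    h.eq_of_convex (t := 1 / 2) hs (hs.pullback G.θ) (by norm_num) (by norm_num) fun b => by
      have hb := G.apply_add_apply_θ (G.pullback_vectorFunctional_ι hρ) b
      change _ = ω (G.P b)
      rw [pullback_apply]
      push_cast
      linear_combination hb / 2
  exact G.pullback_θ_vectorFunctional_ne hρ hp.isState (by rw [heq, pullback_comp_P_θ])

theorem vectorFunctional_apply_apply (hρ : ρ.comp G.ι = ω.gnsStarAlgHom) (hp : IsPureState ω)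
    {τ : B →⋆ₐ[ℂ] B} {τE : E →⋆ₐ[ℂ] E} (hτ : ∀ a, τ (G.ι a) = G.ι (τE a))
    (hτθ : ∀ b, G.θ (τ b) = τ (G.θ b)) (hτE : Function.Surjective τE) (hω : pullback ω τE = ω)
    (b : B) :
    vectorFunctional ρ (gnsVector ω) (τ (τ b)) = vectorFunctional ρ (gnsVector ω) b := by
  set φ := vectorFunctional ρ (gnsVector ω) with hφ
  have hφι (a : E) : φ (G.ι a) = ω a := congr($(G.pullback_vectorFunctional_ι hρ) a)
  have hωτ (a : E) : ω (τE a) = ω a := congr($hω a)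
  obtain ⟨V, hV, hVΩ⟩ := (isCyclicVector_gnsVector ω).exists_linearIsometryEquiv
    (ρ := ω.gnsStarAlgHom.comp τE) (ξ := gnsVector ω)
    ((isCyclicVector_gnsVector ω).mono (by
      rintro _ ⟨a, rfl⟩
      obtain ⟨c, rfl⟩ := hτE a
      exact ⟨c, rfl⟩))
    fun a => by rw [StarAlgHom.comp_apply, inner_gnsVector, inner_gnsVector, hωτ]
  have := hp.isState.nontrivial_gns
  obtain ⟨z, hz, hodd⟩ := G.exists_sign_odd_of_isIntertwiner (hρ ▸ hp.isIrreducibleRep) hτ V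
    (hρ ▸ hV)
  have hφodd {c : B} (hc : G.θ c = -c) : φ (τ c) = z * φ c := by
    rw [hφ, vectorFunctional_apply, vectorFunctional_apply, ← V.inner_map_map (gnsVector ω) (ρ c _),
      ← inner_smul_right, ← hodd c hc, hVΩ]
  have hu := G.θ_ι_mul_u (G.oddCoeff b)
  have hτu : G.θ (τ (G.ι (G.oddCoeff b) * G.u)) = -τ (G.ι (G.oddCoeff b) * G.u) := by
    rw [hτθ, hu, map_neg]
  rw [← G.ι_P_add_ι_oddCoeff_mul_u b, map_add, map_add, map_add, map_add, hφodd hτu, hφodd hu,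
    ← mul_assoc, hz, one_mul, hτ, hτ, hφι, hφι, hωτ, hωτ]

end SameSpace

section Irreducible

variable {E B : Type*} [CStarAlgebra E] [PartialOrder E] [CStarAlgebra B] [PartialOrder B]
  [StarOrderedRing B] (G : GradedExtension E B) {φ : B →ₚ[ℂ] ℂ}

theorem isIrreducibleRep_of_comp_ι (hi : IsIrreducibleRep (φ.gnsStarAlgHom.comp G.ι)) :
    IsIrreducibleRep φ.gnsStarAlgHom := fun Y hY => hi Y fun a => hY (G.ι a)

theorem gnsBicommutant_eq (hi : IsIrreducibleRep (φ.gnsStarAlgHom.comp G.ι)) {S S' : Set B}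
    (hS : S' ⊆ S) (hS' : ∀ a, G.ι a ∈ S') : gnsBicommutant φ S = gnsBicommutant φ S' := by
  refine Set.Subset.antisymm (Set.centralizer_subset fun Y hY => ?_)
    (Set.centralizer_subset (Set.centralizer_subset (Set.image_mono hS)))
  obtain ⟨z, rfl⟩ := hi Y fun a ξ => congr($(hY _ ⟨G.ι a, hS' a, rfl⟩) ξ).symm
  rintro X -
  rw [mul_smul_comm, smul_mul_assoc, one_mul, mul_one]

end Irreducible

end GradedExtension

section WeakLimit

open Filter Topology
open scoped CStarAlgebra

theorem exists_tendsto_inner_apply {𝕜 H ι : Type*} [RCLike 𝕜] [NormedAddCommGroup H]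
    [InnerProductSpace 𝕜 H] [CompleteSpace H] (F : Ultrafilter ι) {T : ι → H →L[𝕜] H} {C : ℝ}
    (hT : ∀ n, ‖T n‖ ≤ C) :
    ∃ L : H →L[𝕜] H, ∀ ξ η, Tendsto (fun n => ⟪T n ξ, η⟫_𝕜) F (𝓝 ⟪L ξ, η⟫_𝕜) := by
  have hbound (ξ η : H) (n : ι) : ‖⟪T n ξ, η⟫_𝕜‖ ≤ C * ‖ξ‖ * ‖η‖ :=
    (norm_inner_le_norm _ _).trans (by gcongr; exact (T n).le_of_opNorm_le (hT n) ξ)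
  have hlim (ξ η : H) : ∃ l, Tendsto (fun n => ⟪T n ξ, η⟫_𝕜) F (𝓝 l) := by
    obtain ⟨l, -, hl⟩ := (isCompact_closedBall (0 : 𝕜) (C * ‖ξ‖ * ‖η‖)).ultrafilter_le_nhds'
      (F.map fun n => ⟪T n ξ, η⟫_𝕜) (Ultrafilter.mem_map.2 (Eventually.of_forall fun n =>
        mem_closedBall_zero_iff.2 (hbound ξ η n)))
    exact ⟨l, hl⟩
  choose b hb using hlim
  have hunique {ξ η : H} {l : 𝕜} (hl : Tendsto (fun n => ⟪T n ξ, η⟫_𝕜) F (𝓝 l)) : b ξ η = l :=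
    tendsto_nhds_unique (hb ξ η) hl
  let B : H →L⋆[𝕜] H →L[𝕜] 𝕜 := LinearMap.mkContinuous₂
    (LinearMap.mk₂'ₛₗ (starRingEnd 𝕜) (RingHom.id 𝕜) b
      (fun ξ ξ' η => hunique (by
        simpa only [map_add, inner_add_left] using (hb ξ η).add (hb ξ' η)))
      (fun r ξ η => hunique (by
        simpa only [map_smul, inner_smul_left, smul_eq_mul] using
          (hb ξ η).const_mul (starRingEnd 𝕜 r)))
      (fun ξ η η' => hunique (by simpa only [inner_add_right] using (hb ξ η).add (hb ξ η')))
      (fun r ξ η => hunique (by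
        simpa only [inner_smul_right, smul_eq_mul, RingHom.id_apply] using
          (hb ξ η).const_mul r)))
    C fun ξ η => le_of_tendsto (hb ξ η).norm (Eventually.of_forall (hbound ξ η))
  refine ⟨InnerProductSpace.continuousLinearMapOfBilin B, fun ξ η => ?_⟩
  rw [InnerProductSpace.continuousLinearMapOfBilin_apply]
  exact hb ξ η

variable {A H ι : Type*} [CStarAlgebra A] [NormedAddCommGroup H] [InnerProductSpace ℂ H]
  [CompleteSpace H] {π : A →⋆ₐ[ℂ] (H →L[ℂ] H)}

theorem IsIntertwiner.of_dense {X : H →L[ℂ] H} {s : Set A} (hs : Dense s)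
    (hX : ∀ a ∈ s, ∀ ξ, X (π a ξ) = π a (X ξ)) : IsIntertwiner π π X := fun a ξ => by
  have hπ : Continuous π := map_continuous π
  exact congrFun (Continuous.ext_on hs (f := fun a => X (π a ξ)) (g := fun a => π a (X ξ))
    (by fun_prop) (by fun_prop) fun a ha => hX a ha ξ) a

theorem IsIrreducibleRep.tendsto_inner_of_asymptotically_central (hi : IsIrreducibleRep π)
    (F : Ultrafilter ι) {D : ι → A} {C : ℝ} (hC : ∀ n, ‖D n‖ ≤ C) {s : Set A} (hs : Dense s)
    (hcomm : ∀ a ∈ s, ∀ᶠ n in F, Commute (D n) a) {Ω : H} (hΩ : ‖Ω‖ = 1) {m : ℂ}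
    (hm : Tendsto (fun n => ⟪Ω, π (D n) Ω⟫_ℂ) F (𝓝 m)) (ξ η : H) :
    Tendsto (fun n => ⟪ξ, π (D n) η⟫_ℂ) F (𝓝 (m * ⟪ξ, η⟫_ℂ)) := by
  obtain ⟨L, hL⟩ := exists_tendsto_inner_apply F fun n =>
    (NonUnitalStarAlgHom.norm_apply_le π (D n)).trans (hC n)
  have hinner (ξ η : H) : Tendsto (fun n => ⟪ξ, π (D n) η⟫_ℂ) F (𝓝 ⟪ξ, L η⟫_ℂ) := by
    simpa only [Function.comp_def, inner_conj_symm] using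
      (Complex.continuous_conj.tendsto _).comp (hL η ξ)
  have hLπ : IsIntertwiner π π L := .of_dense hs fun a ha ξ => ext_inner_left ℂ fun ζ => by
    rw [inner_rep_right]
    refine tendsto_nhds_unique (hinner ζ (π a ξ)) ((hinner (π (star a) ζ) ξ).congr' ?_)
    filter_upwards [hcomm a ha] with n hn
    rw [inner_rep_left, star_star, ← rep_mul_apply, ← rep_mul_apply, hn.eq]
  obtain ⟨z, rfl⟩ := hi L hLπ
  have hz : z = m := by
    refine tendsto_nhds_unique ?_ hm
    simpa [inner_self_eq_norm_sq_to_K, hΩ] using hinner Ω Ω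
  rw [← hz, ← inner_smul_right]
  exact hinner ξ η

theorem commute_of_tendsto_inner {F : Filter ι} [F.NeBot] {D : ι → A} {m : ℂ} (hm : m ≠ 0)
    (hD : ∀ ξ η, Tendsto (fun n => ⟪ξ, π (D n) η⟫_ℂ) F (𝓝 (m * ⟪ξ, η⟫_ℂ)))
    {Y : H →L[ℂ] H} {a : A} (hY : ∀ᶠ n in F, Commute (π (a * D n)) Y) : Commute (π a) Y := by
  refine ContinuousLinearMap.ext fun ξ => ext_inner_left ℂ fun ζ => mul_left_cancel₀ hm ?_
  have hleft := hD (π (star a) ζ) (Y ξ)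
  have hright := hD (π (star a) (Y.adjoint ζ)) ξ
  simp only [inner_rep_left, star_star, ContinuousLinearMap.adjoint_inner_left,
    ← rep_mul_apply] at hleft hright
  refine tendsto_nhds_unique hleft (hright.congr' ?_)
  filter_upwards [hY] with n hn
  exact congr(⟪ζ, $hn.eq.symm ξ⟫_ℂ)

theorem gnsBicommutant_eq_of_asymptotically_central [PartialOrder A] [StarOrderedRing A]
    {φ : A →ₚ[ℂ] ℂ} (hφ : IsState φ) (hi : IsIrreducibleRep φ.gnsStarAlgHom) {θ : A →⋆ₐ[ℂ] A}
    (hθ : ∀ a, θ (θ a) = a) {M : StarSubalgebra ℂ A} (hM : ∀ a ∈ M, θ a ∈ M) (F : Ultrafilter ι)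
    {D : ι → A} {C : ℝ} (hC : ∀ n, ‖D n‖ ≤ C) (hodd : ∀ n, θ (D n) = -D n)
    (hD : ∀ᶠ n in F, D n ∈ M) {s : Set A} (hs : Dense s)
    (hcomm : ∀ a ∈ s, ∀ᶠ n in F, Commute (D n) a) {m : ℂ}
    (hm : Tendsto (fun n => φ (D n)) F (𝓝 m)) (hm0 : m ≠ 0) :
    gnsBicommutant φ M = gnsBicommutant φ {a | a ∈ M ∧ θ a = a} := by
  refine Set.Subset.antisymm (Set.centralizer_subset ?_)
    (Set.centralizer_subset (Set.centralizer_subset (Set.image_mono fun a ha => ha.1)))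
  rintro Y hY _ ⟨a, ha : a ∈ M, rfl⟩
  have hYeven {b : A} (hb : b ∈ M) (hb' : θ b = b) : Commute (φ.gnsStarAlgHom b) Y :=
    hY _ ⟨b, ⟨hb, hb'⟩, rfl⟩
  have heven : Commute (φ.gnsStarAlgHom (a + θ a)) Y :=
    hYeven (add_mem ha (hM a ha)) (by rw [map_add, hθ, add_comm])
  -- The odd part of `a` is `m⁻¹` times the weak limit of the even elements `(a - θ a) * D n`.
  have hoddpart : Commute (φ.gnsStarAlgHom (a - θ a)) Y := by
    refine commute_of_tendsto_inner hm0 (hi.tendsto_inner_of_asymptotically_central F hC hs hcomm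
      hφ.norm_gnsVector (by simpa only [inner_gnsVector] using hm)) ?_
    filter_upwards [hD] with n hn
    refine hYeven (mul_mem (sub_mem ha (hM a ha)) hn) ?_
    rw [map_mul, map_sub, hθ, hodd, mul_neg, ← neg_mul, neg_sub]
  have ha2 : a = (2⁻¹ : ℂ) • (a + θ a + (a - θ a)) := by
    rw [add_add_sub_cancel, ← two_smul ℂ a, inv_smul_smul₀ two_ne_zero]
  rw [ha2, map_smul, map_add]
  exact ((heven.add_left hoddpart).smul_left _).eq

end WeakLimit

namespace JordanWigner

section EvenPart

theorem two_smul_mul_add_Θ (P Q : Op) : (2 : ℂ) • (P * Q + Θ (P * Q)) =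
    (P + Θ P) * (Q + Θ Q) + Θm (T * (P - Θ P)) * (T * (Q - Θ Q)) := by
  have h : Θm (T * (P - Θ P)) * (T * (Q - Θ Q)) = (P - Θ P) * (Q - Θ Q) := by
    rw [← mul_assoc, ← T_mul, ← mul_assoc, T_mul_T, one_mul]
  rw [h, map_mul, two_smul]
  noncomm_ring

theorem two_smul_T_mul_mul_sub_Θ (P Q : Op) : (2 : ℂ) • (T * (P * Q - Θ (P * Q))) =
    Θm (P + Θ P) * (T * (Q - Θ Q)) + T * (P - Θ P) * (Q + Θ Q) := by
  rw [← mul_assoc (Θm _), ← T_mul, map_mul, two_smul]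
  noncomm_ring

theorem mem_of_two_smul_mem {A : StarSubalgebra ℂ Op} {Q : Op} (h : (2 : ℂ) • Q ∈ A) : Q ∈ A :=
  ((Subalgebra.toSubmodule A.toSubalgebra).smul_mem_iff two_ne_zero).1 h

/-- The Jordan-Wigner twist of a `Θ_-`-invariant algebra `A`: the operators whose even part lies in
`A` and whose odd part lies in `T A`. The factors `1 / 2` of the two parts are dropped. -/
def twistedAlgebra (A : StarSubalgebra ℂ Op) (hA : ∀ Q ∈ A, Θm Q ∈ A) : StarSubalgebra ℂ Op where
  carrier := {Q | Q + Θ Q ∈ A ∧ T * (Q - Θ Q) ∈ A}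
  mul_mem' := by
    rintro P Q ⟨hP₀, hP₁⟩ ⟨hQ₀, hQ₁⟩
    refine ⟨mem_of_two_smul_mem ?_, mem_of_two_smul_mem ?_⟩
    · rw [two_smul_mul_add_Θ]
      exact add_mem (mul_mem hP₀ hQ₀) (mul_mem (hA _ hP₁) hQ₁)
    · rw [two_smul_T_mul_mul_sub_Θ]
      exact add_mem (mul_mem (hA _ hP₀) hQ₁) (mul_mem hP₁ hQ₀)
  add_mem' := by
    rintro P Q ⟨hP₀, hP₁⟩ ⟨hQ₀, hQ₁⟩
    constructor
    · rw [map_add, add_add_add_comm]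
      exact add_mem hP₀ hQ₀
    · rw [map_add, add_sub_add_comm, mul_add]
      exact add_mem hP₁ hQ₁
  algebraMap_mem' r := by
    have h : Θ (algebraMap ℂ Op r) = algebraMap ℂ Op r := by
      rw [Algebra.algebraMap_eq_smul_one, map_smul, map_one]
    constructor
    · rw [h]
      exact add_mem (algebraMap_mem _ r) (algebraMap_mem _ r)
    · rw [h, sub_self, mul_zero]
      exact zero_mem _
  star_mem' := by
    rintro P ⟨hP₀, hP₁⟩
    constructor
    · rw [map_star, ← star_add]
      exact star_mem hP₀
    · rw [map_star, ← star_sub, T_mul]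
      simpa only [star_mul, star_T, map_mul, Θm_T] using hA _ (star_mem hP₁)

variable {A : StarSubalgebra ℂ Op} {hA : ∀ Q ∈ A, Θm Q ∈ A} {Q : Op}

theorem mem_twistedAlgebra_of_even (hΘ : Θ Q = Q) (hQ : Q ∈ A) : Q ∈ twistedAlgebra A hA := by
  constructor
  · rw [hΘ]
    exact add_mem hQ hQ
  · rw [hΘ, sub_self, mul_zero]
    exact zero_mem _

theorem mem_twistedAlgebra_of_odd (hΘ : Θ Q = -Q) (hQ : T * Q ∈ A) : Q ∈ twistedAlgebra A hA := by
  constructor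
  · rw [hΘ, add_neg_cancel]
    exact zero_mem _
  · rw [hΘ, sub_neg_eq_add, mul_add]
    exact add_mem hQ hQ

theorem isClosed_twistedAlgebra (h : IsClosed (A : Set Op)) :
    IsClosed (twistedAlgebra A hA : Set Op) := by
  have hΘ : Continuous Θ := continuous_conj parityOp
  exact (h.preimage (continuous_id.add hΘ)).inter
    (h.preimage (continuous_const.mul (continuous_id.sub hΘ)))

theorem generatedBy_le {G : Set Op} {A : StarSubalgebra ℂ Op} (hA : IsClosed (A : Set Op))
    (h : G ⊆ A) : generatedBy G ≤ A :=
  StarSubalgebra.topologicalClosure_minimal (StarAlgebra.adjoin_le h) hA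

theorem σz_mem_car (j : ℤ) : σz j ∈ carAlgebra :=
  sub_mem (carAlgebra.smul_mem (mul_mem (star_mem (c_mem j)) (c_mem j)) _) (one_mem _)

theorem S_mem_car (n : ℤ) : S n ∈ carAlgebra := by
  unfold S
  split_ifs <;> refine list_prod_mem ?_ <;> simp only [List.mem_map] <;>
    rintro _ ⟨k, -, rfl⟩ <;> exact σz_mem_car _

theorem T_mul_σx_mem_car (j : ℤ) : T * σx j ∈ carAlgebra := by
  rw [σx, ← mul_assoc, ← mul_assoc, T_mul_T, one_mul]
  exact mul_mem (S_mem_car j) (add_mem (c_mem j) (star_mem (c_mem j)))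

theorem T_mul_σy_mem_car (j : ℤ) : T * σy j ∈ carAlgebra := by
  rw [σy, mul_smul_comm, ← mul_assoc, ← mul_assoc, T_mul_T, one_mul]
  exact carAlgebra.smul_mem (mul_mem (S_mem_car j) (sub_mem (c_mem j) (star_mem (c_mem j)))) _

theorem spinAlgebra_le_twistedAlgebra : spinAlgebra ≤ twistedAlgebra carAlgebra Θm_mem_car := by
  refine generatedBy_le (isClosed_twistedAlgebra inferInstance) ?_
  rintro _ ((⟨j, -, rfl⟩ | ⟨j, -, rfl⟩) | ⟨j, -, rfl⟩)
  · exact mem_twistedAlgebra_of_odd (Θ_σx j) (T_mul_σx_mem_car j)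
  · exact mem_twistedAlgebra_of_odd (Θ_σy j) (T_mul_σy_mem_car j)
  · exact mem_twistedAlgebra_of_even (Θ_σz j) (σz_mem_car j)

theorem Θ_add_Θ (Q : Op) : Θ (Q + Θ Q) = Q + Θ Q := by rw [map_add, Θ_Θ, add_comm]

theorem add_Θ_mem_evenPart_of_mem_car (hQ : Q ∈ carAlgebra) : Q + Θ Q ∈ evenPart carAlgebra :=
  ⟨add_mem hQ (Θ_mem_car Q hQ), Θ_add_Θ Q⟩

theorem add_Θ_mem_evenPart_of_mem_spin (hQ : Q ∈ spinAlgebra) : Q + Θ Q ∈ evenPart carAlgebra :=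
  ⟨(spinAlgebra_le_twistedAlgebra hQ).1, Θ_add_Θ Q⟩

end EvenPart

section Graded

variable {E A : StarSubalgebra ℂ Op}

/-- The projection `Q ↦ (Q + Θ(Q)) / 2` of a `Θ`-graded algebra onto its even part. -/
def evenProj [IsClosed (E : Set Op)] [IsClosed (A : Set Op)] (hP : ∀ Q ∈ A, Q + Θ Q ∈ E) :
    A →ₚ[ℂ] E :=
  .mk₀
    { toFun := fun Q => ⟨(1 / 2 : ℂ) • (Q + Θ Q), E.smul_mem (hP Q Q.2) _⟩
      map_add' := fun P Q => Subtype.ext (by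
        change (1 / 2 : ℂ) • ((P + Q : Op) + Θ (P + Q)) =
          (1 / 2 : ℂ) • ((P : Op) + Θ P) + (1 / 2 : ℂ) • ((Q : Op) + Θ Q)
        rw [map_add, ← smul_add, add_add_add_comm])
      map_smul' := fun r Q => Subtype.ext (by
        change (1 / 2 : ℂ) • (r • (Q : Op) + Θ (r • (Q : Op))) = r • (1 / 2 : ℂ) • ((Q : Op) + Θ Q)
        rw [map_smul, ← smul_add, smul_comm]) }
    fun Q (hQ : (0 : Op) ≤ Q) => by
      have h : (0 : ℂ) ≤ 1 / 2 := one_div_nonneg.2 zero_le_two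
      exact smul_nonneg h (add_nonneg hQ (map_nonneg Θ hQ))

theorem conj_mem_of_odd (hEA : E ≤ A) (hE : ∀ Q ∈ E, Θ Q = Q) (hP : ∀ Q ∈ A, Q + Θ Q ∈ E)
    {u : unitary Op} (hu : (u : Op) ∈ A) (hΘu : Θ (u : Op) = -u) :
    ∀ Q ∈ E, Unitary.conjStarAlgAut ℂ Op u Q ∈ E := fun Q hQ => by
  rw [Unitary.conjStarAlgAut_apply]
  refine mem_of_two_smul_mem ?_
  have h := hP _ (mul_mem (mul_mem hu (hEA hQ)) (star_mem hu))
  rwa [map_mul, map_mul, map_star, hΘu, hE Q hQ, star_neg, neg_mul, neg_mul_neg, ← two_smul ℂ] at h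

/-- A `Θ`-invariant operator algebra `A` that contains an odd selfadjoint unitary, as a graded
extension of its even part `E`. -/
def gradedOf [IsClosed (E : Set Op)] [IsClosed (A : Set Op)] (hEA : E ≤ A)
    (hA : ∀ Q ∈ A, Θ Q ∈ A) (hE : ∀ Q ∈ E, Θ Q = Q) (hP : ∀ Q ∈ A, Q + Θ Q ∈ E) (u : unitary Op)
    (hu : (u : Op) ∈ A) (hus : star (u : Op) = u) (hΘu : Θ (u : Op) = -u) :
    GradedExtension E A where
  ι := StarSubalgebra.inclusion hEA
  θ := restrictTo Θ A hA
  P := evenProj hP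
  β := restrictTo (Unitary.conjStarAlgAut ℂ Op u) E (conj_mem_of_odd hEA hE hP hu hΘu)
  u := ⟨u, hu⟩
  P_ι Q := Subtype.ext (by
    change (1 / 2 : ℂ) • ((Q : Op) + Θ Q) = Q
    rw [hE Q Q.2, ← two_smul ℂ, smul_smul, one_div_mul_cancel two_ne_zero, one_smul])
  ι_P Q := Subtype.ext (smul_smul _ _ _ |>.trans (by
    rw [mul_one_div_cancel two_ne_zero, one_smul]; rfl))
  θ_u := Subtype.ext hΘu
  star_u := Subtype.ext hus
  u_mul_u := Subtype.ext (by simpa [hus] using Unitary.star_mul_self_of_mem u.2)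
  ι_β Q := Subtype.ext (by
    change Unitary.conjStarAlgAut ℂ Op u Q = (u : Op) * Q * u
    rw [Unitary.conjStarAlgAut_apply, hus])

theorem c_mul_self (j : ℤ) : c j * c j = 0 := by
  have h := car_rel' j j
  rw [← two_smul ℂ] at h
  exact (smul_eq_zero.1 h).resolve_left two_ne_zero

theorem star_c_mul_self (j : ℤ) : star (c j) * star (c j) = 0 := by
  rw [← star_mul, c_mul_self, star_zero]

theorem c_add_star_mul_self (j : ℤ) : (c j + star (c j)) * (c j + star (c j)) = 1 := by
  rw [add_mul, mul_add, mul_add, c_mul_self, star_c_mul_self, zero_add, add_zero, car_rel,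
    if_pos rfl]

theorem star_c_add_star (j : ℤ) : star (c j + star (c j)) = c j + star (c j) := by
  rw [star_add, star_star, add_comm]

/-- The odd selfadjoint unitary `c_1 + c_1^*` of the CAR algebra. -/
def carUnitary : unitary Op :=
  ⟨c 1 + star (c 1), Unitary.mem_iff.2 (by simp only [star_c_add_star, c_add_star_mul_self,
    and_self])⟩

theorem Θ_carUnitary : Θ (carUnitary : Op) = -carUnitary := by
  simp only [carUnitary, map_add, map_star, Θ_c, star_neg, neg_add]

theorem Θm_carUnitary : Θm (carUnitary : Op) = carUnitary := by
  simp [carUnitary, map_star, Θm_c]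

/-- The odd selfadjoint unitary `σ_x^{(1)}` of the spin algebra. -/
def spinUnitary : unitary Op := T * carUnitary

theorem coe_spinUnitary : (spinUnitary : Op) = σx 1 := by
  simp [spinUnitary, carUnitary, σx, S]

theorem star_spinUnitary : star (spinUnitary : Op) = spinUnitary := by
  change star ((T : Op) * carUnitary) = T * carUnitary
  rw [star_mul, star_T, T_mul, Θm_carUnitary]
  exact congr($(star_c_add_star 1) * _)

/-- The CAR algebra as a graded extension of its even part. -/
def gradedCar : GradedExtension (evenPart carAlgebra) carAlgebra :=
  gradedOf inf_le_left Θ_mem_car (fun _ hQ => hQ.2) (fun _ => add_Θ_mem_evenPart_of_mem_car)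
    carUnitary (add_mem (c_mem 1) (star_mem (c_mem 1))) (star_c_add_star 1) Θ_carUnitary

/-- The spin algebra as a graded extension of the even part of the CAR algebra. -/
def gradedSpin : GradedExtension (evenPart carAlgebra) spinAlgebra :=
  gradedOf even_car_le_spin Θ_mem_spin (fun _ hQ => hQ.2)
    (fun _ => add_Θ_mem_evenPart_of_mem_spin) spinUnitary (coe_spinUnitary ▸ σx_mem 1)
    star_spinUnitary (by rw [coe_spinUnitary, Θ_σx])

theorem gradedSpin_β : gradedSpin.β = ΘmEven.comp gradedCar.β :=
  StarAlgHom.ext fun Q => Subtype.ext (by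
    change Unitary.conjStarAlgAut ℂ Op (T * carUnitary) (Q : Op) =
      Unitary.conjStarAlgAut ℂ Op T (Unitary.conjStarAlgAut ℂ Op carUnitary Q)
    rw [map_mul]
    rfl)

theorem Θm_Θm (Q : Op) : Θm (Θm Q) = Q := by
  rw [Θm, Unitary.conjStarAlgAut_apply, Unitary.conjStarAlgAut_apply, star_T]
  rw [mul_assoc, mul_assoc, T_mul_T, mul_one, ← mul_assoc, T_mul_T, one_mul]

theorem ΘmEven_surjective : Function.Surjective ΘmEven :=
  fun Q => ⟨ΘmEven Q, Subtype.ext (Θm_Θm Q)⟩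

theorem ΘmCar_surjective : Function.Surjective ΘmCar :=
  fun Q => ⟨ΘmCar Q, Subtype.ext (Θm_Θm Q)⟩

end Graded

section Translation

theorem τ_add (j k : ℤ) (Q : Op) : τ (j + k) Q = τ j (τ k Q) := by
  rw [τ, zpow_add, map_mul]
  rfl

theorem τ_τ_neg (j : ℤ) (Q : Op) : τ j (τ (-j) Q) = Q := by
  rw [← τ_add, add_neg_cancel]
  simp [τ]

theorem commute_parityOp_shiftOp : Commute parityOp shiftOp :=
  Subtype.ext (Op.ext fun v p => by
    change (-1) ^ p.1.card * ((if p.2 then -1 else 1) * v (shift p)) =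
      (if p.2 then -1 else 1) * ((-1) ^ (shift p).1.card * v (shift p))
    have h : (shift p).1.card = p.1.card := by simp [shift]
    rw [h, mul_left_comm])

theorem Θ_τ (j : ℤ) (Q : Op) : Θ (τ j Q) = τ j (Θ Q) := by
  have h : Θ * τ j = τ j * Θ := by
    rw [Θ, τ, ← map_mul, ← map_mul, (commute_parityOp_shiftOp.zpow_right j).eq]
  exact congr($h Q)

theorem τ_mem_even (j : ℤ) : ∀ Q ∈ evenPart carAlgebra, τ j Q ∈ evenPart carAlgebra :=
  fun Q hQ => mem_evenPart.2 ⟨τ_mem_car j Q hQ.1, by rw [Θ_τ, (mem_evenPart.1 hQ).2]⟩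

/-- The lattice translation `τ_j` of the even part of the CAR algebra. -/
def τEven (j : ℤ) : evenPart carAlgebra →⋆ₐ[ℂ] evenPart carAlgebra :=
  restrictTo (τ j) (evenPart carAlgebra) (τ_mem_even j)

theorem τEven_surjective (j : ℤ) : Function.Surjective (τEven j) :=
  fun Q => ⟨τEven (-j) Q, Subtype.ext (τ_τ_neg j Q)⟩

theorem pullback_evenRestriction_τEven {ψ : carAlgebra →ₚ[ℂ] ℂ} (h : TranslationInvariantCar ψ)
    (j : ℤ) : pullback (evenRestriction ψ) (τEven j) = evenRestriction ψ := by
  ext Q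
  exact congr($(h j) (gradedCar.ι Q))

end Translation

section Locality

theorem τ_apply_of_τ_one {f : ℤ → Op} (hf : ∀ j, τ 1 (f j) = f (j + 1)) (k j : ℤ) :
    τ k (f j) = f (j + k) := by
  induction k using Int.induction_on generalizing j with
  | zero => simp [τ]
  | succ i ih => rw [τ_add, hf, ih, add_assoc, add_comm 1]
  | pred i ih =>
    have h : τ (-1) (f j) = f (j - 1) := τ_neg_one (by rw [hf, sub_add_cancel])
    rw [sub_eq_add_neg, τ_add, h, ih, sub_add_eq_add_sub, add_sub_assoc, sub_eq_add_neg]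

/-- Change the occupation of the site `j` and exchange the two copies of Fock space. Up to a sign,
this is `σ_x^{(j)}`. -/
def siteFlip (j : ℤ) : Op :=
  weightedPerm ((toggle j).trans boolFlip) 1 fun _ => norm_one.le

theorem siteFlip_apply (j : ℤ) (v : Space) (p : Config) :
    siteFlip j v p = v (symmDiff p.1 {j}, !p.2) := one_mul _

theorem commute_siteFlip (j k : ℤ) : Commute (siteFlip j) (siteFlip k) :=
  Op.ext fun v p => by simp only [Op.mul_apply, siteFlip_apply, symmDiff_right_comm]

theorem commute_siteFlip_σz {j k : ℤ} (h : j ≠ k) : Commute (siteFlip j) (σz k) :=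
  Op.ext fun v p => by
    have hk : k ∈ symmDiff p.1 {j} ↔ k ∈ p.1 := by simp [Finset.mem_symmDiff, h.symm]
    simp only [Op.mul_apply, siteFlip_apply, σz_apply, hk]

theorem τ_one_siteFlip (j : ℤ) : τ 1 (siteFlip j) = -siteFlip (j + 1) := by
  rw [τ, zpow_one]
  refine conj_eq _ (Op.ext fun v p => ?_)
  have h : shift (symmDiff p.1 {j + 1}, !p.2) = (symmDiff (shift p).1 {j}, !(shift p).2) := by
    ext k
    · simp [shift, Finset.mem_symmDiff]
    · simp [shift]
  simp only [Op.mul_apply, neg_mul, Op.neg_apply, siteFlip_apply, shift_apply, h]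
  cases p.2 <;> simp

theorem σx_one : σx 1 = siteFlip 1 := Op.ext fun v p => by
  have h₁ : σx 1 v p = (T : Op) ((c 1 + star (c 1)) v) p := by rw [← coe_spinUnitary]; rfl
  have h₂ : p.1.filter (· < 1) = p.1.filter (· ≤ 0) := Finset.filter_congr fun k _ => by lia
  rw [h₁, siteFlip_apply, T_apply, Op.add_apply, c_apply, star_c_apply, ← add_mul, h₂, ← mul_assoc]
  split_ifs <;> simp [neg_one_pow_mul_self]

theorem σx_eq (j : ℤ) : σx j = (-1 : ℂ) ^ (j - 1) • siteFlip j := by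
  have hflip (k : ℤ) : τ 1 ((-1 : ℂ) ^ (k - 1) • siteFlip k) =
      (-1 : ℂ) ^ (k + 1 - 1) • siteFlip (k + 1) := by
    rw [map_smul, τ_one_siteFlip, add_sub_right_comm, zpow_add_one₀ (by simp), mul_neg_one,
      neg_smul, smul_neg]
  have h := τ_apply_of_τ_one hflip (j - 1) 1
  rw [sub_self, zpow_zero, one_smul, ← σx_one, τ_apply_of_τ_one τ_one_σx] at h
  simpa only [add_sub_cancel] using h

theorem commute_σx_σx (j k : ℤ) : Commute (σx j) (σx k) := by
  rw [σx_eq, σx_eq]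
  exact ((commute_siteFlip j k).smul_left _).smul_right _

theorem commute_σx_σz {j k : ℤ} (h : j ≠ k) : Commute (σx j) (σz k) := by
  rw [σx_eq]
  exact (commute_siteFlip_σz h).smul_left _

theorem σy_eq (j : ℤ) : σy j = Complex.I • (σx j * σz j) := by
  have h₁ : c j * (star (c j) * c j) = c j := by
    rw [← mul_assoc, eq_sub_of_add_eq (car_rel j j), if_pos rfl, sub_mul, mul_assoc, c_mul_self,
      mul_zero, sub_zero, one_mul]
  have h₂ : (c j + star (c j)) * σz j = c j - star (c j) := by
    rw [σz, mul_sub, mul_one, mul_smul_comm, add_mul, h₁, ← mul_assoc, star_c_mul_self, zero_mul,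
      add_zero, two_smul]
    abel
  rw [σy, σx, mul_assoc (T * S j : Op), h₂]

theorem star_σx (j : ℤ) : star (σx j) = σx j := by
  have h₁ : star (σx 1) = σx 1 := by rw [← coe_spinUnitary, star_spinUnitary]
  have h := τ_apply_of_τ_one τ_one_σx (j - 1) 1
  rw [add_sub_cancel] at h
  rw [← h, ← map_star, h₁]

theorem star_σz (j : ℤ) : star (σz j) = σz j := by simp [σz]

theorem commute_of_mem_generatedBy {G M : Set Op} (hM : ∀ b ∈ M, star b ∈ M)
    (h : ∀ a ∈ G, ∀ b ∈ M, Commute a b) {a b : Op} (ha : a ∈ generatedBy G) (hb : b ∈ M) :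
    Commute a b := by
  have hle : generatedBy G ≤ StarSubalgebra.centralizer ℂ M := by
    refine generatedBy_le ?_ fun a ha => ?_
    · rw [StarSubalgebra.coe_centralizer]
      exact Set.isClosed_centralizer _
    · rw [SetLike.mem_coe, StarSubalgebra.mem_centralizer_iff]
      exact fun b hb => ⟨(h a ha b hb).eq.symm, (h a ha _ (hM b hb)).eq.symm⟩
  exact ((StarSubalgebra.mem_centralizer_iff ℂ).1 (hle ha) b hb).1.symm

theorem commute_generatedBy {G₁ G₂ : Set Op} (h₂ : ∀ b ∈ G₂, star b = b)
    (h : ∀ a ∈ G₁, ∀ b ∈ G₂, Commute a b) {P Q : Op} (hP : P ∈ generatedBy G₁)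
    (hQ : Q ∈ generatedBy G₂) : Commute P Q := by
  have hPG (b : Op) (hb : b ∈ G₂) : Commute P b :=
    commute_of_mem_generatedBy (fun b hb => (h₂ b hb).symm ▸ hb) h hP hb
  refine (commute_of_mem_generatedBy (M := {P, star P}) ?_ (fun b hb => ?_) hQ (.inl rfl)).symm
  · rintro _ (rfl | rfl) <;> simp
  · rintro _ (rfl | rfl)
    · exact (hPG b hb).symm
    · exact h₂ b hb ▸ (hPG b hb).symm.star_star

theorem spinAlgebraOn_le_generatedBy (Λ : Set ℤ) :
    spinAlgebraOn Λ ≤ generatedBy (σx '' Λ ∪ σz '' Λ) := by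
  have hx (j : ℤ) (hj : j ∈ Λ) : σx j ∈ generatedBy (σx '' Λ ∪ σz '' Λ) :=
    mem_generatedBy (.inl ⟨j, hj, rfl⟩)
  have hz (j : ℤ) (hj : j ∈ Λ) : σz j ∈ generatedBy (σx '' Λ ∪ σz '' Λ) :=
    mem_generatedBy (.inr ⟨j, hj, rfl⟩)
  refine generatedBy_le inferInstance ?_
  rintro _ ((⟨j, hj, rfl⟩ | ⟨j, hj, rfl⟩) | ⟨j, hj, rfl⟩)
  · exact hx j hj
  · rw [σy_eq]
    exact StarSubalgebra.smul_mem _ (mul_mem (hx j hj) (hz j hj)) _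
  · exact hz j hj

theorem commute_of_disjoint {Λ Λ' : Set ℤ} (hd : Disjoint Λ Λ') {P Q : Op}
    (hP : P ∈ spinAlgebraOn Λ) (hQ : Q ∈ spinAlgebraOn Λ') : Commute P Q := by
  refine commute_generatedBy ?_ ?_ (spinAlgebraOn_le_generatedBy Λ hP)
    (spinAlgebraOn_le_generatedBy Λ' hQ)
  · rintro _ (⟨j, -, rfl⟩ | ⟨j, -, rfl⟩)
    exacts [star_σx j, star_σz j]
  · rintro _ (⟨j, hj, rfl⟩ | ⟨j, hj, rfl⟩) _ (⟨k, hk, rfl⟩ | ⟨k, hk, rfl⟩)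
    · exact commute_σx_σx j k
    · exact commute_σx_σz (hd.ne_of_mem hj hk)
    · exact (commute_σx_σz (hd.ne_of_mem hj hk).symm).symm
    · exact σz_comm j k

theorem spinAlgebraOn_mono {Λ Λ' : Set ℤ} (h : Λ ⊆ Λ') : spinAlgebraOn Λ ≤ spinAlgebraOn Λ' :=
  StarSubalgebra.topologicalClosure_mono (StarAlgebra.adjoin_mono (by gcongr))

theorem spinAlgebraOn_le_spinAlgebra (Λ : Set ℤ) : spinAlgebraOn Λ ≤ spinAlgebra :=
  spinAlgebraOn_mono (Set.subset_univ Λ)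

instance (Λ : Set ℤ) : IsClosed (spinAlgebraOn Λ : Set Op) :=
  inferInstanceAs (IsClosed (generatedBy _ : Set Op))

section

variable {Λ : Set ℤ} {j : ℤ}

theorem σx_mem_spinAlgebraOn (hj : j ∈ Λ) : σx j ∈ spinAlgebraOn Λ :=
  mem_generatedBy (.inl (.inl ⟨j, hj, rfl⟩))

theorem σy_mem_spinAlgebraOn (hj : j ∈ Λ) : σy j ∈ spinAlgebraOn Λ :=
  mem_generatedBy (.inl (.inr ⟨j, hj, rfl⟩))

theorem σz_mem_spinAlgebraOn (hj : j ∈ Λ) : σz j ∈ spinAlgebraOn Λ :=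
  mem_generatedBy (.inr ⟨j, hj, rfl⟩)

end

theorem Θ_mem_spinAlgebraOn (Λ : Set ℤ) : ∀ Q ∈ spinAlgebraOn Λ, Θ Q ∈ spinAlgebraOn Λ :=
  conj_mem _ inferInstance (by
    rintro _ ((⟨j, hj, rfl⟩ | ⟨j, hj, rfl⟩) | ⟨j, hj, rfl⟩)
    · exact (Θ_σx j).symm ▸ neg_mem (σx_mem_spinAlgebraOn hj)
    · exact (Θ_σy j).symm ▸ neg_mem (σy_mem_spinAlgebraOn hj)
    · exact (Θ_σz j).symm ▸ σz_mem_spinAlgebraOn hj)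

theorem τ_mem_spinAlgebraOn {Λ Λ' : Set ℤ} (k : ℤ) (h : ∀ j ∈ Λ, j + k ∈ Λ') :
    ∀ Q ∈ spinAlgebraOn Λ, τ k Q ∈ spinAlgebraOn Λ' :=
  conj_mem _ inferInstance (by
    rintro _ ((⟨j, hj, rfl⟩ | ⟨j, hj, rfl⟩) | ⟨j, hj, rfl⟩)
    · exact (τ_apply_of_τ_one τ_one_σx k j).symm ▸ σx_mem_spinAlgebraOn (h j hj)
    · exact (τ_apply_of_τ_one τ_one_σy k j).symm ▸ σy_mem_spinAlgebraOn (h j hj)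
    · exact (τ_apply_of_τ_one τ_one_σz k j).symm ▸ σz_mem_spinAlgebraOn (h j hj))

theorem spinAlgebraOn_Icc_mono {M N : ℕ} (h : M ≤ N) :
    spinAlgebraOn (Set.Icc (-M) M) ≤ spinAlgebraOn (Set.Icc (-N) N) :=
  spinAlgebraOn_mono (Set.Icc_subset_Icc (by lia) (by lia))

/-- The algebra of strictly local observables. -/
def localAlgebra : StarSubalgebra ℂ Op where
  carrier := {Q | ∃ N : ℕ, Q ∈ spinAlgebraOn (Set.Icc (-N) N)}
  mul_mem' := by
    rintro P Q ⟨N, hP⟩ ⟨M, hQ⟩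
    exact ⟨max N M, mul_mem (spinAlgebraOn_Icc_mono (le_max_left N M) hP)
      (spinAlgebraOn_Icc_mono (le_max_right N M) hQ)⟩
  add_mem' := by
    rintro P Q ⟨N, hP⟩ ⟨M, hQ⟩
    exact ⟨max N M, add_mem (spinAlgebraOn_Icc_mono (le_max_left N M) hP)
      (spinAlgebraOn_Icc_mono (le_max_right N M) hQ)⟩
  algebraMap_mem' r := ⟨0, algebraMap_mem _ r⟩
  star_mem' := fun ⟨N, hP⟩ => ⟨N, star_mem hP⟩

theorem spinAlgebra_le_closure_localAlgebra : spinAlgebra ≤ localAlgebra.topologicalClosure := by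
  have hj (j : ℤ) : j ∈ Set.Icc (-(j.natAbs : ℤ)) j.natAbs := by constructor <;> lia
  refine StarSubalgebra.topologicalClosure_mono (StarAlgebra.adjoin_le ?_)
  rintro _ ((⟨j, -, rfl⟩ | ⟨j, -, rfl⟩) | ⟨j, -, rfl⟩)
  · exact ⟨j.natAbs, σx_mem_spinAlgebraOn (hj j)⟩
  · exact ⟨j.natAbs, σy_mem_spinAlgebraOn (hj j)⟩
  · exact ⟨j.natAbs, σz_mem_spinAlgebraOn (hj j)⟩

theorem dense_localAlgebra : Dense {Q : spinAlgebra | (Q : Op) ∈ localAlgebra} := fun Q => by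
  rw [closure_subtype]
  refine closure_mono ?_ (spinAlgebra_le_closure_localAlgebra Q.2)
  rintro P ⟨N, hN⟩
  exact ⟨⟨P, spinAlgebraOn_le_spinAlgebra _ hN⟩, ⟨N, hN⟩, rfl⟩

end Locality

section CarStates

theorem gradedCar_P_ΘmCar (Q : carAlgebra) : gradedCar.P (ΘmCar Q) = ΘmEven (gradedCar.P Q) := by
  have hΘ : Θ (Θm (Q : Op)) = Θm (Θ Q) := by
    have h : parityOp * T = T * parityOp := Subtype.ext parity_mul_T
    have h' : Θ * Θm = Θm * Θ := by rw [Θ, Θm, ← map_mul, ← map_mul, h]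
    exact congr($h' (Q : Op))
  refine gradedCar.eq_of_two_smul_ι ?_
  change _ = (2 : ℂ) • ΘmCar (gradedCar.ι (gradedCar.P Q))
  rw [gradedCar.ι_P, ← map_smul, gradedCar.ι_P, map_add]
  exact congr(ΘmCar Q + $(Subtype.ext hΘ))

variable {ψ : carAlgebra →ₚ[ℂ] ℂ}

theorem eq_evenRestriction_comp_P (hΘ : pullback ψ ΘCar = ψ) :
    ψ = (evenRestriction ψ).comp gradedCar.P :=
  gradedCar.eq_comp_P hΘ rfl

theorem isPureState_evenRestriction_comp_P (hψ : IsPureState ψ) (hΘ : pullback ψ ΘCar = ψ) :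
    IsPureState ((evenRestriction ψ).comp gradedCar.P) :=
  eq_evenRestriction_comp_P hΘ ▸ hψ

theorem isPureState_evenRestriction (hψ : IsPureState ψ) (hΘ : pullback ψ ΘCar = ψ) :
    IsPureState (evenRestriction ψ) :=
  gradedCar.isPureState_of_comp_P (isPureState_evenRestriction_comp_P hψ hΘ)

theorem not_repEquiv_gradedCar_β (hψ : IsPureState ψ) (hΘ : pullback ψ ΘCar = ψ) :
    ¬ RepEquiv (evenRestriction ψ).gnsStarAlgHom
      ((evenRestriction ψ).gnsStarAlgHom.comp gradedCar.β) :=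
  gradedCar.not_repEquiv_of_isPureState_comp_P (isPureState_evenRestriction_comp_P hψ hΘ)

theorem unitarilyEquivalent_of_repEquiv_gradedSpin_β (hψ : IsPureState ψ)
    (hΘ : pullback ψ ΘCar = ψ)
    (h : RepEquiv (evenRestriction ψ).gnsStarAlgHom
      ((evenRestriction ψ).gnsStarAlgHom.comp gradedSpin.β)) :
    UnitarilyEquivalent ψ (pullback ψ ΘmCar) := by
  rw [gradedSpin_β] at h
  have h' := gradedCar.unitarilyEquivalent_comp_P (isPureState_evenRestriction_comp_P hψ hΘ)
    (not_repEquiv_gradedCar_β hψ hΘ) ΘmCar_surjective gradedCar_P_ΘmCar h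
  rwa [← eq_evenRestriction_comp_P hΘ] at h'

theorem not_repEquiv_gradedSpin_β (hψ : IsPureState ψ) (hΘ : pullback ψ ΘCar = ψ)
    (h : UnitarilyEquivalent (evenRestriction ψ) (pullback (evenRestriction ψ) ΘmEven)) :
    ¬ RepEquiv (evenRestriction ψ).gnsStarAlgHom
      ((evenRestriction ψ).gnsStarAlgHom.comp gradedSpin.β) := by
  rw [gradedSpin_β]
  exact fun h' => not_repEquiv_gradedCar_β hψ hΘ
    (repEquiv_comp_of_unitarilyEquivalent ΘmEven_surjective h h')

theorem repEquiv_gradedSpin_β (hψ : IsPureState ψ) (hΘ : pullback ψ ΘCar = ψ)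
    (h : UnitarilyEquivalent ψ (pullback ψ ΘmCar))
    (hne : ¬ UnitarilyEquivalent (evenRestriction ψ) (pullback (evenRestriction ψ) ΘmEven)) :
    RepEquiv (evenRestriction ψ).gnsStarAlgHom
      ((evenRestriction ψ).gnsStarAlgHom.comp gradedSpin.β) := by
  rw [gradedSpin_β]
  exact gradedCar.repEquiv_of_unitarilyEquivalent (isPureState_evenRestriction hψ hΘ) rfl
    ΘmEven_surjective (fun _ => rfl) h hne

end CarStates

section SpinStates

variable {ω : evenPart carAlgebra →ₚ[ℂ] ℂ}

theorem τSpin_ι (j : ℤ) (Q : evenPart carAlgebra) :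
    τSpin j (gradedSpin.ι Q) = gradedSpin.ι (τEven j Q) := rfl

theorem τSpin_add (j k : ℤ) (Q : spinAlgebra) : τSpin (j + k) Q = τSpin j (τSpin k Q) :=
  Subtype.ext (τ_add j k Q)

theorem τSpin_zero (Q : spinAlgebra) : τSpin 0 Q = Q :=
  Subtype.ext (by simp [τSpin, restrictTo, τ])

theorem ΘSpin_τSpin (j : ℤ) (Q : spinAlgebra) : ΘSpin (τSpin j Q) = τSpin j (ΘSpin Q) :=
  Subtype.ext (Θ_τ j Q)

theorem ΘSpin_ΘSpin (Q : spinAlgebra) : ΘSpin (ΘSpin Q) = Q := Subtype.ext (Θ_Θ Q)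

theorem translationInvariantSpin_comp_P (h : ∀ j, pullback ω (τEven j) = ω) :
    TranslationInvariantSpin (ω.comp gradedSpin.P) := fun j => by
  refine gradedSpin.eq_comp_P (PositiveLinearMap.ext fun Q => ?_)
    (PositiveLinearMap.ext fun Q => ?_)
  · change ω (gradedSpin.P (τSpin j (ΘSpin Q))) = ω (gradedSpin.P (τSpin j Q))
    rw [← ΘSpin_τSpin]
    exact congr(ω $(gradedSpin.P_θ _))
  · change ω (gradedSpin.P (τSpin j (gradedSpin.ι Q))) = ω Q
    rw [τSpin_ι, gradedSpin.P_ι, ← pullback_apply, h]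

theorem exists_invariant_extension (hp : IsPureState ω)
    (hne : ¬ RepEquiv ω.gnsStarAlgHom (ω.gnsStarAlgHom.comp gradedSpin.β)) :
    ∃ φ : spinAlgebra →ₚ[ℂ] ℂ,
      (IsState φ ∧ pullback φ ΘSpin = φ ∧ IsExtension φ ω) ∧
      (∀ φ' : spinAlgebra →ₚ[ℂ] ℂ, pullback φ' ΘSpin = φ' → IsExtension φ' ω → φ' = φ) ∧
      IsPureState φ ∧ ((∀ j, pullback ω (τEven j) = ω) → TranslationInvariantSpin φ) :=
  ⟨ω.comp gradedSpin.P,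
    ⟨gradedSpin.isState_comp_P hp.isState, gradedSpin.pullback_comp_P_θ ω,
      gradedSpin.pullback_comp_P_ι ω⟩,
    fun _ h h' => gradedSpin.eq_comp_P h h', gradedSpin.isPureState_comp_P hp hne,
    translationInvariantSpin_comp_P⟩

theorem exists_noninvariant_extension (hp : IsPureState ω)
    (he : RepEquiv ω.gnsStarAlgHom (ω.gnsStarAlgHom.comp gradedSpin.β)) :
    ∃ φ : spinAlgebra →ₚ[ℂ] ℂ, IsState φ ∧ IsExtension φ ω ∧ pullback φ ΘSpin ≠ φ ∧
      (∃ U : ω.GNS ≃ₗᵢ[ℂ] φ.GNS, U (gnsVector ω) = gnsVector φ ∧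
        ∀ Q ξ, U (ω.gnsStarAlgHom Q ξ) = φ.gnsStarAlgHom (evenToSpin Q) (U ξ)) ∧
      (pullback ω (τEven 1) = ω → pullback φ (τSpin 2) = φ) := by
  have := hp.isState.nontrivial_gns
  obtain ⟨ρ, hρ⟩ := gradedSpin.exists_rep_comp_ι_eq hp.isIrreducibleRep he
  refine ⟨vectorFunctional ρ (gnsVector ω), gradedSpin.isState_vectorFunctional hρ hp.isState,
    gradedSpin.pullback_vectorFunctional_ι hρ,
    gradedSpin.pullback_θ_vectorFunctional_ne hρ hp.isState,
    gradedSpin.exists_gns_vectorFunctional_equiv hρ, fun ht => PositiveLinearMap.ext fun Q => ?_⟩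
  rw [pullback_apply, ← one_add_one_eq_two, τSpin_add]
  exact gradedSpin.vectorFunctional_apply_apply hρ hp (τSpin_ι 1) (ΘSpin_τSpin 1)
    (τEven_surjective 1) ht Q

theorem spinBicommutant_evenPart {φ : spinAlgebra →ₚ[ℂ] ℂ}
    (hi : IsIrreducibleRep (φ.gnsStarAlgHom.comp gradedSpin.ι)) :
    spinBicommutant φ spinAlgebra = spinBicommutant φ (evenPart spinAlgebra) :=
  gradedSpin.gnsBicommutant_eq hi (fun Q _ => Q.2) fun a =>
    mem_evenPart.2 ⟨(gradedSpin.ι a).2, (mem_evenPart.1 a.2).2⟩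

end SpinStates

section HalfChain

open Filter Topology

variable {φ : spinAlgebra →ₚ[ℂ] ℂ}

theorem exists_odd_local_apply_ne_zero (hφ : pullback φ ΘSpin ≠ φ) :
    ∃ (N : ℕ) (Q : spinAlgebra), (Q : Op) ∈ spinAlgebraOn (Set.Icc (-N) N) ∧
      ΘSpin Q = -Q ∧ φ Q ≠ 0 := by
  by_contra! h
  have hΘ : Continuous ΘSpin :=
    ((continuous_conj parityOp).comp continuous_subtype_val).subtype_mk _
  have hφc : Continuous φ := map_continuous φ
  refine hφ (DFunLike.coe_injective
    (Continuous.ext_on dense_localAlgebra (hφc.comp hΘ) hφc fun Q hQ => ?_))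
  obtain ⟨N, hQ⟩ := hQ
  have h₀ := h N (ΘSpin Q - Q) (sub_mem (Θ_mem_spinAlgebraOn _ _ hQ) hQ)
    (by rw [map_sub, ΘSpin_ΘSpin, neg_sub])
  rw [map_sub] at h₀
  exact sub_eq_zero.1 h₀

theorem apply_τSpin_two_mul (h : pullback φ (τSpin 2) = φ) (k : ℤ) (Q : spinAlgebra) :
    φ (τSpin (2 * k) Q) = φ Q := by
  have h₂ (Q) : φ (τSpin 2 Q) = φ Q := congr($h Q)
  induction k with
  | zero => rw [mul_zero, τSpin_zero]
  | succ n ih => rw [mul_add, mul_one, add_comm, τSpin_add, h₂, ih]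
  | pred n ih => rw [← h₂, ← τSpin_add, mul_sub, mul_one, add_sub_cancel, ih]

theorem eventually_commute_τSpin {N : ℕ} {P Q : spinAlgebra}
    (hQ : (Q : Op) ∈ spinAlgebraOn (Set.Icc (-N) N)) (hP : (P : Op) ∈ localAlgebra) {ε : ℤ}
    (hε : ε = 1 ∨ ε = -1) : ∀ᶠ n : ℕ in atTop, Commute (τSpin (2 * (ε * n)) Q) P := by
  obtain ⟨M, hM⟩ := hP
  filter_upwards [eventually_gt_atTop (N + M)] with n hn
  have hτQ : τ (2 * (ε * n)) (Q : Op) ∈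
      spinAlgebraOn (Set.Icc (-N + 2 * (ε * n)) (N + 2 * (ε * n))) :=
    τ_mem_spinAlgebraOn _ (fun j hj => Set.mem_Icc.2 ⟨by linarith [hj.1], by linarith [hj.2]⟩) _ hQ
  refine Subtype.ext (commute_of_disjoint (Set.disjoint_left.2 ?_) hτQ hM)
  rintro j ⟨h₁, h₂⟩ ⟨h₃, h₄⟩
  rcases hε with rfl | rfl <;> lia

theorem spinBicommutant_spinAlgebraOn (hs : IsState φ) (hi : IsIrreducibleRep φ.gnsStarAlgHom)
    (hφ : pullback φ ΘSpin ≠ φ) (hτ : pullback φ (τSpin 2) = φ) {Λ : Set ℤ} {ε : ℤ}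
    (hε : ε = 1 ∨ ε = -1)
    (hΛ : ∀ N : ℕ, ∀ᶠ n : ℕ in atTop, ∀ j ∈ Set.Icc (-N : ℤ) N, j + 2 * (ε * n) ∈ Λ) :
    spinBicommutant φ (spinAlgebraOn Λ) = spinBicommutant φ (evenPart (spinAlgebraOn Λ)) := by
  obtain ⟨N, Q, hQ, hodd, hQ₀⟩ := exists_odd_local_apply_ne_zero hφ
  let M : StarSubalgebra ℂ spinAlgebra := (spinAlgebraOn Λ).comap spinAlgebra.subtype
  have hatTop {p : ℕ → Prop} (h : ∀ᶠ n in atTop, p n) : ∀ᶠ n in hyperfilter ℕ, p n :=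
    Nat.hyperfilter_le_atTop h
  have heven : {P | P ∈ M ∧ ΘSpin P = P} =
      {P : spinAlgebra | (P : Op) ∈ evenPart (spinAlgebraOn Λ)} :=
    Set.ext fun P => and_congr_right fun _ => Subtype.ext_iff
  have h := gnsBicommutant_eq_of_asymptotically_central hs hi ΘSpin_ΘSpin (M := M)
    (fun P hP => Θ_mem_spinAlgebraOn Λ P hP) (hyperfilter ℕ)
    (D := fun n => τSpin (2 * (ε * n)) Q) (C := ‖Q‖)
    (fun n => NonUnitalStarAlgHom.norm_apply_le (τSpin (2 * (ε * n))) Q)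
    (fun n => by rw [ΘSpin_τSpin, hodd, map_neg])
    (hatTop ((hΛ N).mono fun n hn => τ_mem_spinAlgebraOn _ hn _ hQ)) dense_localAlgebra
    (fun P hP => hatTop (eventually_commute_τSpin hQ hP hε))
    (by simpa only [apply_τSpin_two_mul hτ] using tendsto_const_nhds) hQ₀
  rwa [heven] at h

theorem spinBicommutant_Iic_zero (hs : IsState φ) (hi : IsIrreducibleRep φ.gnsStarAlgHom)
    (hφ : pullback φ ΘSpin ≠ φ) (hτ : pullback φ (τSpin 2) = φ) :
    spinBicommutant φ (spinAlgebraOn (Set.Iic 0)) =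
      spinBicommutant φ (evenPart (spinAlgebraOn (Set.Iic 0))) := by
  refine spinBicommutant_spinAlgebraOn hs hi hφ hτ (.inr rfl) fun N => ?_
  filter_upwards [eventually_ge_atTop N] with n hn j ⟨_, hj⟩
  simp only [Set.mem_Iic]
  lia

theorem spinBicommutant_Ici_one (hs : IsState φ) (hi : IsIrreducibleRep φ.gnsStarAlgHom)
    (hφ : pullback φ ΘSpin ≠ φ) (hτ : pullback φ (τSpin 2) = φ) :
    spinBicommutant φ (spinAlgebraOn (Set.Ici 1)) =
      spinBicommutant φ (evenPart (spinAlgebraOn (Set.Ici 1))) := by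
  refine spinBicommutant_spinAlgebraOn hs hi hφ hτ (.inl rfl) fun N => ?_
  filter_upwards [eventually_gt_atTop N] with n hn j ⟨hj, _⟩
  simp only [Set.mem_Ici]
  lia

end HalfChain

end JordanWigner

end

theorem mainTheorem7 (ψ : carAlgebra →ₚ[ℂ] ℂ) (hψ : IsPureState ψ)
    (hΘ : pullback ψ ΘCar = ψ) :
    -- (i)
    (¬ UnitarilyEquivalent ψ (pullback ψ ΘmCar) →
      ∃ φ : spinAlgebra →ₚ[ℂ] ℂ,
        (IsState φ ∧ pullback φ ΘSpin = φ ∧ IsExtension φ (evenRestriction ψ)) ∧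
        (∀ φ' : spinAlgebra →ₚ[ℂ] ℂ, IsState φ' → pullback φ' ΘSpin = φ' →
          IsExtension φ' (evenRestriction ψ) → φ' = φ) ∧
        IsPureState φ ∧
        (TranslationInvariantCar ψ → TranslationInvariantSpin φ)) ∧
    -- (ii)
    (UnitarilyEquivalent ψ (pullback ψ ΘmCar) →
      UnitarilyEquivalent (evenRestriction ψ) (pullback (evenRestriction ψ) ΘmEven) →
      ∃ φ : spinAlgebra →ₚ[ℂ] ℂ,
        (IsState φ ∧ pullback φ ΘSpin = φ ∧ IsExtension φ (evenRestriction ψ)) ∧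
        (∀ φ' : spinAlgebra →ₚ[ℂ] ℂ, IsState φ' → pullback φ' ΘSpin = φ' →
          IsExtension φ' (evenRestriction ψ) → φ' = φ) ∧
        IsPureState φ ∧
        (TranslationInvariantCar ψ → TranslationInvariantSpin φ)) ∧
    -- (iii)
    (UnitarilyEquivalent ψ (pullback ψ ΘmCar) →
      ¬ UnitarilyEquivalent (evenRestriction ψ) (pullback (evenRestriction ψ) ΘmEven) →
      ∃ φ : spinAlgebra →ₚ[ℂ] ℂ,
        IsPureState φ ∧ IsExtension φ (evenRestriction ψ) ∧ pullback φ ΘSpin ≠ φ ∧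
        (∃ U : (evenRestriction ψ).GNS ≃ₗᵢ[ℂ] φ.GNS,
          U (gnsVector (evenRestriction ψ)) = gnsVector φ ∧
          ∀ (Q : evenPart carAlgebra) (ξ : (evenRestriction ψ).GNS),
            U ((evenRestriction ψ).gnsStarAlgHom Q ξ) = φ.gnsStarAlgHom (evenToSpin Q) (U ξ)) ∧
        spinBicommutant φ spinAlgebra = spinBicommutant φ (evenPart spinAlgebra) ∧
        (TranslationInvariantCar ψ →
          pullback φ (τSpin 2) = φ ∧
          spinBicommutant φ (spinAlgebraOn (Set.Iic 0)) =
            spinBicommutant φ (evenPart (spinAlgebraOn (Set.Iic 0))) ∧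
          spinBicommutant φ (spinAlgebraOn (Set.Ici 1)) =
            spinBicommutant φ (evenPart (spinAlgebraOn (Set.Ici 1))))) := by
  have hp := isPureState_evenRestriction hψ hΘ
  refine ⟨fun h => ?_, fun _ h => ?_, fun h h' => ?_⟩
  · obtain ⟨φ, hφ, hunique, hpure, hτ⟩ := exists_invariant_extension hp fun he =>
      h (unitarilyEquivalent_of_repEquiv_gradedSpin_β hψ hΘ he)
    exact ⟨φ, hφ, fun φ' _ => hunique φ', hpure,
      fun ht => hτ (pullback_evenRestriction_τEven ht)⟩
  · obtain ⟨φ, hφ, hunique, hpure, hτ⟩ :=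
      exists_invariant_extension hp (not_repEquiv_gradedSpin_β hψ hΘ h)
    exact ⟨φ, hφ, fun φ' _ => hunique φ', hpure,
      fun ht => hτ (pullback_evenRestriction_τEven ht)⟩
  · obtain ⟨φ, hs, hι, hθ, ⟨U, hUΩ, hU⟩, hτ⟩ :=
      exists_noninvariant_extension hp (repEquiv_gradedSpin_β hψ hΘ h h')
    have hi : IsIrreducibleRep (φ.gnsStarAlgHom.comp gradedSpin.ι) :=
      hp.isIrreducibleRep.of_repEquiv ⟨U, hU⟩
    have hi' := gradedSpin.isIrreducibleRep_of_comp_ι hi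
    refine ⟨φ, .of_isIrreducibleRep hs hi', hι, hθ, ⟨U, hUΩ, hU⟩, spinBicommutant_evenPart hi,
      fun ht => ?_⟩
    have hτ' := hτ (pullback_evenRestriction_τEven ht 1)
    exact ⟨hτ', spinBicommutant_Iic_zero hs hi' hθ hτ', spinBicommutant_Ici_one hs hi' hθ hτ'⟩
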